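/- Theorem 1. Let $D$ be a natural number, $\mathcal D=\{1,\dots,D\}$, and let each color $c\in\mathcal D$ have a parity $|c|\in\{0,1\}$ and a dimension $N_c\in\mathbb N$, with $N_c$ even if $|c|=1$. Let $g^c$ be $\delta_{ab}$ on $\{1,\dots,N_c\}$ if $|c|=0$ (symmetry group $O(N_c)$) and the canonical symplectic form $\omega_{ab}$ if $|c|=1$ (symmetry group $Sp(N_c)$). The components $T^{a_1\dots a_D}$, $1\le a_c\le N_c$, of the tensor commute if $\sum_c|c|$ is even and anticommute if it is odd. *Graphs and invariants.* For a set $C$ of colors, an undirected $C$-colored graph is a vertex set with one pairing of the vertices (the edges of color $c$) for every $c\in C$; in a directed graph each pair is ordered. The number $F_{c/c'}$ of faces of colors $c/c'$ is the number of cycles of edges alternating between $c$ and $c'$. The sign $\epsilon(\vec P,\vec P')$ of two directed pairings $\{(i_1,i_2),\dots,(i_{2k-1},i_{2k})\}$ and $\{(j_1,j_2),\dots,(j_{2k-1},j_{2k})\}$ is the sign of the permutation $i_m\mapsto j_m$. A $D$-colored graph $\mathcal B$ with vertices $1,\dots,2k=|V(\mathcal B)|$ and an arbitrary directed version of it with edge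 sets $\vec E^c$ define the trace invariant $$I_{\mathcal B}(T)=\sum_{a^1,\dots,a^{2k}}T^{a^1}T^{a^2}\cdots T^{a^{2k}}\prod_{c\in\mathcal D}\Big(\epsilon(\vec P_{ref},\vec E^c)^{|c|}\prod_{(i,j)\in\vec E^c}g^c_{a^i_c a^j_c}\Big),\qquad \vec P_{ref}=\{(1,2),\dots,(2k-1,2k)\}.$$ *Model.* Let $\mathfrak B$ be any set of connected $D$-colored graphs with labeled vertices and more than two vertices (for instance all of them, or one from each isomorphism class), with formal coupling constants $\lambda_{\mathcal B}$, $\mathcal B\in\mathfrak B$, and let $$S[T]=\tfrac12\,g(T,T)+\sum_{\mathcal B\in\mathfrak B}\frac{\lambda_{\mathcal B}}{|V(\mathcal B)|}I_{\mathcal B}(T),\qquad g(T,T)=\sum_{a,b}T^{a}T^{b}\prod_c g^c_{a_cb_c}.$$ The perturbative series of $Z=\int e^{-S[T]}[dT]$ and of $\langle I_{\mathcal B}(T)\rangle=Z^{-1}\int e^{-S[T]}I_{\mathcal B}(T)[dT]$ are the formal power series in the couplings obtained by expanding the exponential of the interaction and integrating term by term against $e^{-\frac12 g(T,T)}[dT]$,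 normalized to total mass $1$. This is a Berezin integral for anticommuting components, and for commuting components an ordinary Gaussian integral (over the contour on which $T$ is real along the eigenvectors of the symmetric matrix $\bigotimes_c g^c$ for the eigenvalue $1$ and imaginary along those for $-1$; this is the real space if all colors are even). *Claim.* (a) As a formal sum, in which every coefficient receives only finitely many nonzero contributions, $$Z=\sum_{\mathcal G}K(\{\lambda\},\mathcal G)\prod_{c\in\mathcal D}\big((-1)^{|c|}N_c\big)^{F_{c/0}(\mathcal G)},\qquad K(\{\lambda\},\mathcal G)=\frac1{n!}\prod_{i=1}^{n}\frac{-\lambda_{\mathcal B_i}}{|V(\mathcal B_i)|},$$ where $\mathcal G$ runs over the undirected $(D+1)$-colored graphs, with colors $\{0\}\cup\mathcal D$, whose maximal subgraph of colors in $\mathcal D$ is a disjoint union $\mathcal B_1\sqcup\dots\sqcup\mathcal B_n$, $n\ge0$, of labeled bubbles $\mathcal B_i\in\mathfrak B$. (b) For every $D$-colored graph $\mathcal B$ with labeled vertices, $$\langle I_{\mathcal B}(T)\rangle=\sum_{\mathcal G}K(\{\lambda\},\mathcal G)\prod_{c\in\mathcal D}\big((-1)^{|c|}N_c\big)^{F_{c/0}(\mathcal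 G)}$$ as a formal sum, with the same $K$, where now $\mathcal G$ runs over the undirected $(D+1)$-colored graphs whose maximal subgraph of colors in $\mathcal D$ is $\mathcal B\sqcup\mathcal B_1\sqcup\dots\sqcup\mathcal B_n$, with $\mathcal B$ marked, with labeled bubbles $\mathcal B_i\in\mathfrak B$, and such that every connected component of $\mathcal G$ meets $\mathcal B$. If $\mathcal B$ is connected, all these $\mathcal G$ are connected. (c) The sets of graphs in (a), (b) and the factor $K$ do not depend on the $|c|$ and $N_c$. For integers $N_c$ of any sign, the term of every graph $\mathcal G$ is unchanged when, for the colors $c$ in an arbitrary subset of $\mathcal D$, one replaces $|c|$ by $1-|c|$ (exchanging $O(N_c)\leftrightarrow Sp(N_c)$) and $N_c$ by $-N_c$. -/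

import Mathlib

noncomputable section

namespace TensorModel

/-! ### Edge-colored graphs -/

/-- An undirected closed edge-colored graph on the vertex set `V` with colors `C`: for every color
`c` the edges of color `c` form a pairing of the vertices, given by the map `mate c` that sends
each vertex to the other end of its edge of color `c`. -/
@[ext]
structure ColoredGraph (C V : Type) where
  mate : C → V → V
  mate_mate : ∀ c v, mate c (mate c v) = v
  mate_ne : ∀ c v, mate c v ≠ v

/-- The simple graph on the vertices spanned by the edges whose color lies in `S`. -/
def ColoredGraph.restrictColors {C V : Type} (G : ColoredGraph C V) (S : Set C) : SimpleGraph V :=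
  SimpleGraph.fromRel fun v w => ∃ c ∈ S, G.mate c v = w

/-- The number of faces of colors `c/c'`, that is, of cycles of edges alternating between the two
colors: these are the connected components of the graph formed by the edges of colors `c`, `c'`. -/
def ColoredGraph.faces {C V : Type} (G : ColoredGraph C V) (c c' : C) : ℕ :=
  Nat.card (G.restrictColors {c, c'}).ConnectedComponent

/-- Connectedness of a colored graph. -/
def ColoredGraph.Connected {C V : Type} (G : ColoredGraph C V) : Prop :=
  (G.restrictColors Set.univ).Connected

/-- An undirected `D`-colored graph with labeled vertices `0, …, 2k - 1`, as a pair `⟨k, graph⟩`. -/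
abbrev TraceGraph (D : ℕ) : Type := Σ k : ℕ, ColoredGraph (Fin D) (Fin (2 * k))

/-- The number of vertices. -/
def TraceGraph.order {D : ℕ} (B : TraceGraph D) : ℕ := 2 * B.1

/-- A directed pairing `{(i₁, i₂), …, (i₂ₖ₋₁, i₂ₖ)}` of `2k` vertices: the `l`-th pair is
`(P (l, 0), P (l, 1))`.  The order in which the pairs are listed is immaterial, since
exchanging two pairs is an even permutation of the vertices. -/
abbrev DirectedPairing (k : ℕ) : Type := Fin k × Fin 2 ≃ Fin (2 * k)

/-- The reference pairing `{(0, 1), (2, 3), …, (2k - 2, 2k - 1)}`. -/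
def refPairing (k : ℕ) : DirectedPairing k :=
  finProdFinEquiv.trans (finCongr (Nat.mul_comm k 2))

/-- The sign of two directed pairings: the sign of the permutation that takes
`i₁ … i₂ₖ` into `j₁ … j₂ₖ`. -/
def pairingSign {k : ℕ} (P Q : DirectedPairing k) : ℤˣ := Equiv.Perm.sign (P.symm.trans Q)

/-- A directed `D`-colored graph on the vertices `0, …, 2k - 1`: one directed pairing per color. -/
abbrev DirectedGraph (D k : ℕ) : Type := Fin D → DirectedPairing k

/-- The undirected graph obtained by forgetting the directions of the edges. -/
def DirectedGraph.undirected {D k : ℕ} (E : DirectedGraph D k) :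
    ColoredGraph (Fin D) (Fin (2 * k)) where
  mate c v := E c (((E c).symm v).1, ((E c).symm v).2 + 1)
  mate_mate c v := by
    have h : ∀ x : Fin 2, x + 1 + 1 = x := by decide
    simp [h]
  mate_ne c v h := by
    have h2 : ∀ x : Fin 2, x + 1 ≠ x := by decide
    have h3 := congrArg (fun w => ((E c).symm w).2) h
    simp [h2] at h3

/-! ### Tensors and trace invariants

`par c` is the parity `|c|` of the color `c`, and `N c` is the dimension `N_c`. -/

/-- Multi-indices `a = (a_1, …, a_D)` of a tensor. -/
abbrev Idx {D : ℕ} (N : Fin D → ℕ) : Type := (c : Fin D) → Fin (N c)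

/-- The canonical symplectic form, with blocks `0, 1, -1, 0` (for even `n`). -/
def omega (n : ℕ) : Matrix (Fin n) (Fin n) ℂ :=
  Matrix.of fun a b =>
    if (b : ℕ) = a + n / 2 then 1 else if (a : ℕ) = b + n / 2 then -1 else 0

/-- The form `g^c` on a space of dimension `n` and parity `p`. -/
def form (p : Fin 2) (n : ℕ) : Matrix (Fin n) (Fin n) ℂ := if p = 0 then 1 else omega n

/-- The form `∏_c g^c` on tensors, as a matrix indexed by multi-indices. -/
def formMatrix {D : ℕ} (par : Fin D → Fin 2) (N : Fin D → ℕ) : Matrix (Idx N) (Idx N) ℂ :=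
  Matrix.of fun a b => ∏ c, form (par c) (N c) (a c) (b c)

/-- The quadratic invariant `g(T, T) = ∑ T^a T^b ∏_c g^c_{a_c b_c}`. -/
def quadratic {D : ℕ} (par : Fin D → Fin 2) (N : Fin D → ℕ) {A : Type} [Ring A] [Algebra ℂ A]
    (T : Idx N → A) : A :=
  ∑ a, ∑ b, formMatrix par N a b • (T a * T b)

/-- The trace invariant of a directed `D`-colored graph, for a tensor `T` with components in an
algebra `A`.  The components are multiplied in the order given by the reference pairing. -/
def traceInvariant {D : ℕ} (par : Fin D → Fin 2) (N : Fin D → ℕ) {A : Type} [Ring A] [Algebra ℂ A]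
    (T : Idx N → A) {k : ℕ} (E : DirectedGraph D k) : A :=
  ∑ a : Fin (2 * k) → Idx N,
    (∏ c, (((pairingSign (refPairing k) (E c) : ℤ) : ℂ) ^ (par c : ℕ) *
      ∏ l : Fin k, form (par c) (N c) (a (E c (l, 0)) c) (a (E c (l, 1)) c))) •
    (List.ofFn fun i => T (a i)).prod

/-! ### Gaussian integrals -/

/-- The contour `T = C x`, `x` real, with `C = (1 + g) / 2 + i (1 - g) / 2`, used for commuting
components.  When the form `g` is symmetric with `g² = 1`, this is real on the eigenspace of `g`
for the eigenvalue `1` and imaginary on the one for `-1`, so that `g(C x, C x) = ∑ x_a²`.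
It is the real space when all the colors are even. -/
def contour {D : ℕ} (par : Fin D → Fin 2) (N : Fin D → ℕ) (x : Idx N → ℝ) : Idx N → ℂ :=
  ((1 / 2 : ℂ) • (1 + formMatrix par N) + (Complex.I / 2) • (1 - formMatrix par N)).mulVec
    (fun a => (x a : ℂ))

/-- The integral `∫ e^{- g(T, T) / 2} f(T) dT` over commuting components (not normalized). -/
def bosonGaussianIntegral {D : ℕ} (par : Fin D → Fin 2) (N : Fin D → ℕ)
    (f : MvPolynomial (Idx N) ℂ) : ℂ :=
  ∫ x : Idx N → ℝ, Complex.exp (-(1 / 2) * quadratic par N (contour par N x)) *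
    MvPolynomial.eval (contour par N x) f

/-- The normalized Gaussian expectation value for commuting components. -/
def bosonGaussian {D : ℕ} (par : Fin D → Fin 2) (N : Fin D → ℕ)
    (f : MvPolynomial (Idx N) ℂ) : ℂ :=
  bosonGaussianIntegral par N f / bosonGaussianIntegral par N 1

/-- The Grassmann algebra generated by the tensor components. -/
abbrev Grassmann {D : ℕ} (N : Fin D → ℕ) : Type := ExteriorAlgebra ℂ (Idx N → ℂ)

/-- The generator `T^a` of the Grassmann algebra. -/
def grassmannVar {D : ℕ} (N : Fin D → ℕ) (a : Idx N) : Grassmann N :=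
  ExteriorAlgebra.ι ℂ (Pi.single a (1 : ℂ))

/-- The left derivative with respect to `T^a`. -/
def grassmannDeriv {D : ℕ} (N : Fin D → ℕ) (a : Idx N) : Grassmann N →ₗ[ℂ] Grassmann N :=
  CliffordAlgebra.contractLeft (LinearMap.proj a)

/-- The Berezin integral `∫ ∏_a dT^a f`: the iterated derivative with respect to all the
generators.  The order of the generators only affects the overall sign. -/
def berezin {D : ℕ} (N : Fin D → ℕ) (f : Grassmann N) : ℂ :=
  ExteriorAlgebra.algebraMapInv
    ((Finset.univ : Finset (Idx N)).toList.foldr (fun a h => grassmannDeriv N a h) f)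

/-- The integral `∫ e^{- g(T, T) / 2} f(T) dT` over anticommuting components (not normalized). -/
def fermionGaussianIntegral {D : ℕ} (par : Fin D → Fin 2) (N : Fin D → ℕ) (f : Grassmann N) : ℂ :=
  berezin N (IsNilpotent.exp (-(1 / 2 : ℂ) • quadratic par N (grassmannVar N)) * f)

/-- The normalized Gaussian expectation value for anticommuting components. -/
def fermionGaussian {D : ℕ} (par : Fin D → Fin 2) (N : Fin D → ℕ) (f : Grassmann N) : ℂ :=
  fermionGaussianIntegral par N f / fermionGaussianIntegral par N 1

/-! ### Perturbative series

Formal power series in the coupling constants `λ_B`, one for each graph `B` in the set `𝔅` of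
interactions.  `rep` picks a directed representative of every undirected graph. -/

/-- The interaction part `∑_B λ_B / |V(B)| I_B(T)` of the action. -/
def interaction {D : ℕ} (par : Fin D → Fin 2) (N : Fin D → ℕ) (𝔅 : Set (TraceGraph D))
    (rep : (B : TraceGraph D) → DirectedGraph D B.1) {A : Type} [Ring A] [Algebra ℂ A]
    (T : Idx N → A) : MvPowerSeries 𝔅 A :=
  fun p => ∑ᶠ B : 𝔅, MvPowerSeries.coeff p (MvPowerSeries.monomial (Finsupp.single B 1)
    ((B.1.order : ℂ)⁻¹ • traceInvariant par N T (rep B.1)))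

/-- The exponential of a formal power series without constant term: the power `F ^ n` does not
contribute to the coefficients of degree less than `n`. -/
def formalExp {σ A : Type} [Ring A] [Algebra ℂ A] (F : MvPowerSeries σ A) : MvPowerSeries σ A :=
  fun p => ∑ n ∈ Finset.range (p.degree + 1),
    ((n.factorial : ℂ)⁻¹) • MvPowerSeries.coeff p (F ^ n)

/-- The perturbative series of `∫ dμ[T] f(T)`: the interaction part of `e^{-S}` is expanded in the
coupling constants and the Gaussian expectation `E` is taken term by term. -/
def perturb {D : ℕ} (par : Fin D → Fin 2) (N : Fin D → ℕ) (𝔅 : Set (TraceGraph D))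
    (rep : (B : TraceGraph D) → DirectedGraph D B.1) {A : Type} [Ring A] [Algebra ℂ A]
    (T : Idx N → A) (E : A → ℂ) (f : A) : MvPowerSeries 𝔅 ℂ :=
  fun p => E (MvPowerSeries.coeff p (formalExp (-interaction par N 𝔅 rep T)) * f)

open Classical in
/-- The partition function `Z = ∫ dμ[T]`.  The components anticommute if the number of odd colors
is odd, and commute otherwise. -/
def partitionFunction {D : ℕ} (par : Fin D → Fin 2) (N : Fin D → ℕ) (𝔅 : Set (TraceGraph D))
    (rep : (B : TraceGraph D) → DirectedGraph D B.1) : MvPowerSeries 𝔅 ℂ :=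
  if Odd (∑ c, (par c : ℕ)) then
    perturb par N 𝔅 rep (grassmannVar N) (fermionGaussian par N) 1
  else
    perturb par N 𝔅 rep MvPolynomial.X (bosonGaussian par N) 1

open Classical in
/-- The integral `∫ dμ[T] I_B(T)`. -/
def invariantIntegral {D : ℕ} (par : Fin D → Fin 2) (N : Fin D → ℕ) (𝔅 : Set (TraceGraph D))
    (rep : (B : TraceGraph D) → DirectedGraph D B.1) (B : TraceGraph D) : MvPowerSeries 𝔅 ℂ :=
  if Odd (∑ c, (par c : ℕ)) then
    perturb par N 𝔅 rep (grassmannVar N) (fermionGaussian par N)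
      (traceInvariant par N (grassmannVar N) (rep B))
  else
    perturb par N 𝔅 rep MvPolynomial.X (bosonGaussian par N)
      (traceInvariant par N MvPolynomial.X (rep B))

/-- The expectation value `⟨I_B(T)⟩ = Z⁻¹ ∫ dμ[T] I_B(T)`. -/
def expectation {D : ℕ} (par : Fin D → Fin 2) (N : Fin D → ℕ) (𝔅 : Set (TraceGraph D))
    (rep : (B : TraceGraph D) → DirectedGraph D B.1) (B : TraceGraph D) : MvPowerSeries 𝔅 ℂ :=
  (partitionFunction par N 𝔅 rep)⁻¹ * invariantIntegral par N 𝔅 rep B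

/-- `F` is the formal sum of the family `f` of formal power series: each coefficient receives
finitely many nonzero contributions, and it is their sum. -/
def IsFormalSum {σ ι : Type} (f : ι → MvPowerSeries σ ℂ) (F : MvPowerSeries σ ℂ) : Prop :=
  ∀ p, {G | MvPowerSeries.coeff p (f G) ≠ 0}.Finite ∧
    MvPowerSeries.coeff p F = ∑ᶠ G, MvPowerSeries.coeff p (f G)

/-! ### Feynman graphs -/

/-- The vertex set of the disjoint union of the graphs `b 0, …, b (n - 1)`. -/
abbrev UnionVertex {D n : ℕ} (b : Fin n → TraceGraph D) : Type := Σ i : Fin n, Fin (2 * (b i).1)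

/-- The `(D + 1)`-colored graph `G` on the disjoint union of the vertices of `b 0, …, b (n - 1)`
has the disjoint union of these graphs as its maximal `D`-colored subgraph.  The additional color
is `0 : Fin (D + 1)`, and `c : Fin D` becomes `c.succ`. -/
def Extends {D n : ℕ} (b : Fin n → TraceGraph D)
    (G : ColoredGraph (Fin (D + 1)) (UnionVertex b)) : Prop :=
  ∀ (c : Fin D) (i : Fin n) (v : Fin (2 * (b i).1)),
    G.mate c.succ ⟨i, v⟩ = ⟨i, (b i).2.mate c v⟩

/-- `(D + 1)`-colored graphs with labeled bubbles taken from `𝔅`. -/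
structure FeynmanGraph {D : ℕ} (𝔅 : Set (TraceGraph D)) : Type where
  /-- the number of bubbles -/
  n : ℕ
  bubble : Fin n → 𝔅
  graph : ColoredGraph (Fin (D + 1)) (UnionVertex fun i => (bubble i).1)
  extends_bubbles : Extends (fun i => (bubble i).1) graph

/-- `(D + 1)`-colored graphs that contain `B` as a marked subgraph (at position `0`), whose other
bubbles are labeled and taken from `𝔅`, and each connected component of which meets `B`. -/
structure MarkedFeynmanGraph {D : ℕ} (𝔅 : Set (TraceGraph D)) (B : TraceGraph D) : Type where
  /-- the number of bubbles besides `B` -/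
  n : ℕ
  bubble : Fin n → 𝔅
  graph : ColoredGraph (Fin (D + 1))
    (UnionVertex (Fin.cons B fun i => (bubble i).1 : Fin (n + 1) → TraceGraph D))
  extends_bubbles : Extends _ graph
  meets_marked : ∀ v, ∃ w : Fin (2 * B.1), (graph.restrictColors Set.univ).Reachable v ⟨0, w⟩

/-- The factor `(1 / n!) ∏_i (-λ_{B_i} / |V(B_i)|)` of a list of bubbles. -/
def couplingFactor {D : ℕ} {𝔅 : Set (TraceGraph D)} {n : ℕ} (b : Fin n → 𝔅) :
    MvPowerSeries 𝔅 ℂ :=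
  MvPowerSeries.C ((n.factorial : ℂ)⁻¹) *
    ∏ i, (MvPowerSeries.C (-((b i).1.order : ℂ)⁻¹) * MvPowerSeries.X (b i))

/-- The factor `∏_c ((-1)^|c| N_c)^{F_{c/0}(G)}`, for integers `N_c`. -/
def faceFactor {D : ℕ} (par : Fin D → Fin 2) (N : Fin D → ℤ) {V : Type}
    (G : ColoredGraph (Fin (D + 1)) V) : ℤ :=
  ∏ c : Fin D, ((-1) ^ (par c : ℕ) * N c) ^ G.faces c.succ 0

/-- The term of a graph in the series of the partition function. -/
def FeynmanGraph.amplitude {D : ℕ} {𝔅 : Set (TraceGraph D)} (par : Fin D → Fin 2) (N : Fin D → ℤ)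
    (G : FeynmanGraph 𝔅) : MvPowerSeries 𝔅 ℂ :=
  couplingFactor G.bubble * MvPowerSeries.C ((faceFactor par N G.graph : ℤ) : ℂ)

/-- The term of a graph in the series of the expectation value of an invariant. -/
def MarkedFeynmanGraph.amplitude {D : ℕ} {𝔅 : Set (TraceGraph D)} {B : TraceGraph D}
    (par : Fin D → Fin 2) (N : Fin D → ℤ) (G : MarkedFeynmanGraph 𝔅 B) : MvPowerSeries 𝔅 ℂ :=
  couplingFactor G.bubble * MvPowerSeries.C ((faceFactor par N G.graph : ℤ) : ℂ)

/-- Exchange `O(N_c)` and `Sp(N_c)` for the colors `c` in `s`. -/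
def flipParity {D : ℕ} (s : Finset (Fin D)) (par : Fin D → Fin 2) : Fin D → Fin 2 :=
  fun c => if c ∈ s then par c + 1 else par c

/-- Exchange `N_c` and `-N_c` for the colors `c` in `s`. -/
def flipSize {D : ℕ} (s : Finset (Fin D)) (N : Fin D → ℤ) : Fin D → ℤ :=
  fun c => if c ∈ s then -N c else N c

end TensorModel

end

set_option linter.unusedSectionVars false

noncomputable section

namespace TensorModel

/-! ### Operations on colored graphs -/

namespace ColoredGraph

variable {C V W U : Type}

/-! Every Gaussian expectation of a product of trace invariants is a sum over pairings of the
tensors, and for each pairing the index sums and the signs factor over the colors. The whole theorem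
rests on one identity for a single color: if the forms `g` are contracted along the edges of color
`c` and their transposes along the edges of color `0`, and the sign of one directed pairing relative
to the other is raised to the power `|c|`, the result is `((-1)^|c| N_c)^F`, where `F` is the number
of faces (`faceSum_eq`).

For this identity, each face is an even cycle, so its vertices can be colored alternately. Reversing
an edge changes the sign of the pairing and exchanges the arguments of `g`; the two factors
`(-1)^|c|` cancel. Thus all edges may be directed from the first class to the second. The relative
permutation then respects the classes, its sign is that of a permutation `γ` of the pairs whose
cycles are the faces, and summing over the indices of one class leaves `g² = (-1)^|c|` once per
pair. The number of pairs cancels from the exponent of `-1`.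

The Gaussian input is isolated in `IsGaussian`: integration by parts and the behavior of words under
permutations. It is proved for commuting components from one-dimensional moments and a linear change
of variables, and for anticommuting ones from the vanishing of Berezin integrals of derivatives. The
covariance is the transpose of the form, which is its inverse. Wick's theorem follows in both cases
at once (`IsGaussian.wick`), with the sign of the permutation raised to the total parity. This sign
supplies one factor per color, which removes the reference pairing from the definition of the
invariants (`sum_traceCoeff_mul`). Hence the expectation of a product of invariants is `extSum`, the
sum of the face factors over all ways to add the edges of color `0` (`expectation_traceInvariant`,
`expectation_prod`).

Expanding the exponential of the interaction gives (a). For (b), each graph with a marked bubble is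
uniquely the disjoint union of the components that meet this bubble and a vacuum graph
(`extSum_eq_sum_split`). The factors `1/n!` turn this into a product of formal series
(`bubbleSeries_mul`), and division by `Z`, whose constant term is `1`, leaves the first factor. The
duality holds because amplitudes contain only the products `(-1)^|c| N_c`. -/

/-- The colored graph obtained by relabeling the vertices. -/
def map (e : V ≃ W) (G : ColoredGraph C V) : ColoredGraph C W where
  mate c w := e (G.mate c (e.symm w))
  mate_mate c w := by simp [G.mate_mate]
  mate_ne c w h := G.mate_ne c (e.symm w) (by rw [e.eq_symm_apply]; exact h)

@[simp] lemma map_mate_apply (e : V ≃ W) (G : ColoredGraph C V) (c : C) (v : V) :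
    (G.map e).mate c (e v) = e (G.mate c v) := by simp [map]

lemma map_map (e : V ≃ W) (e' : W ≃ U) (G : ColoredGraph C V) :
    (G.map e).map e' = G.map (e.trans e') := rfl

@[simp] lemma map_symm_map (e : V ≃ W) (G : ColoredGraph C V) : (G.map e).map e.symm = G := by
  ext c v; simp [map]

@[simp] lemma map_map_symm (e : V ≃ W) (G : ColoredGraph C W) : (G.map e.symm).map e = G := by
  ext c v; simp [map]

lemma map_injective (e : V ≃ W) : Function.Injective (map (C := C) e) :=
  Function.LeftInverse.injective (g := map e.symm) (map_symm_map e)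

/-- The disjoint union of two colored graphs. -/
def sum (G : ColoredGraph C V) (H : ColoredGraph C W) : ColoredGraph C (V ⊕ W) where
  mate c := Sum.map (G.mate c) (H.mate c)
  mate_mate c v := by rcases v with v | v <;> simp [mate_mate]
  mate_ne c v := by rcases v with v | v <;> simp [mate_ne]

@[simp] lemma sum_mate_inl (G : ColoredGraph C V) (H : ColoredGraph C W) (c : C) (v : V) :
    (G.sum H).mate c (Sum.inl v) = Sum.inl (G.mate c v) := rfl

@[simp] lemma sum_mate_inr (G : ColoredGraph C V) (H : ColoredGraph C W) (c : C) (v : W) :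
    (G.sum H).mate c (Sum.inr v) = Sum.inr (H.mate c v) := rfl

/-- The disjoint union of a family of colored graphs. -/
def sigma {ι : Type} {V : ι → Type} (G : ∀ i, ColoredGraph C (V i)) :
    ColoredGraph C (Σ i, V i) where
  mate c x := ⟨x.1, (G x.1).mate c x.2⟩
  mate_mate c x := by simp [mate_mate]
  mate_ne c x h := by
    rcases x with ⟨i, v⟩
    simp only [Sigma.mk.injEq, heq_eq_eq, true_and] at h
    exact (G i).mate_ne c v h

@[simp] lemma sigma_mate {ι : Type} {V : ι → Type} (G : ∀ i, ColoredGraph C (V i)) (c : C)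
    (i : ι) (v : V i) : (sigma G).mate c ⟨i, v⟩ = ⟨i, (G i).mate c v⟩ := rfl

/-- The subgraph of the edges of nonzero color. -/
def tail {D : ℕ} (G : ColoredGraph (Fin (D + 1)) V) : ColoredGraph (Fin D) V where
  mate c := G.mate c.succ
  mate_mate c := G.mate_mate c.succ
  mate_ne c := G.mate_ne c.succ

@[simp] lemma tail_mate {D : ℕ} (G : ColoredGraph (Fin (D + 1)) V) (c : Fin D) :
    G.tail.mate c = G.mate c.succ := rfl

lemma tail_map {D : ℕ} (e : V ≃ W) (G : ColoredGraph (Fin (D + 1)) V) :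
    (G.map e).tail = G.tail.map e := rfl

lemma tail_sum {D : ℕ} (G : ColoredGraph (Fin (D + 1)) V) (H : ColoredGraph (Fin (D + 1)) W) :
    (G.sum H).tail = G.tail.sum H.tail := rfl

instance [Finite C] [Finite V] : Finite (ColoredGraph C V) :=
  Finite.of_injective (fun G : ColoredGraph C V => G.mate) fun _ _ h => ColoredGraph.ext h

instance [Finite C] [Finite V] : Fintype (ColoredGraph C V) := Fintype.ofFinite _

/-! ### Reachability and faces -/

lemma reachable_mate (G : ColoredGraph C V) {S : Set C} {c : C} (hc : c ∈ S) (v : V) :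
    (G.restrictColors S).Reachable v (G.mate c v) := by
  refine SimpleGraph.Adj.reachable ?_
  rw [restrictColors, SimpleGraph.fromRel_adj]
  exact ⟨(G.mate_ne c v).symm, Or.inl ⟨c, hc, rfl⟩⟩

lemma reachable_induction (G : ColoredGraph C V) {S : Set C} {r : V → V → Prop}
    (refl : ∀ v, r v v) (trans : ∀ u v w, r u v → r v w → r u w)
    (step : ∀ c ∈ S, ∀ v, r v (G.mate c v)) {v w : V}
    (h : (G.restrictColors S).Reachable v w) : r v w := by
  obtain ⟨p⟩ := h
  induction p with
  | nil => exact refl _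
  | cons hadj _ ih =>
    refine trans _ _ _ ?_ ih
    rw [restrictColors, SimpleGraph.fromRel_adj] at hadj
    rcases hadj.2 with ⟨c, hc, rfl⟩ | ⟨c, hc, rfl⟩
    · exact step c hc _
    -- An edge traversed backwards is again a step along `mate`, which is an involution.
    · simpa [G.mate_mate] using step c hc (G.mate c _)

lemma reachable_closed (G : ColoredGraph C V) {S : Set C} {p : V → Prop}
    (hp : ∀ c ∈ S, ∀ v, p v → p (G.mate c v)) {v w : V}
    (h : (G.restrictColors S).Reachable v w) : p v → p w :=
  G.reachable_induction (r := fun v w => p v → p w) (fun _ => id)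
    (fun _ _ _ h1 h2 h => h2 (h1 h)) hp h

lemma reachable_hom (G : ColoredGraph C V) (H : ColoredGraph C W) (f : V → W) {S : Set C}
    (hf : ∀ c ∈ S, ∀ v, f (G.mate c v) = H.mate c (f v)) {v w : V}
    (h : (G.restrictColors S).Reachable v w) : (H.restrictColors S).Reachable (f v) (f w) :=
  G.reachable_induction (r := fun v w => (H.restrictColors S).Reachable (f v) (f w))
    (fun _ => .refl _) (fun _ _ _ h1 h2 => h1.trans h2)
    (fun c hc v => by rw [hf c hc]; exact H.reachable_mate hc _) h

/-- Functions that are constant along the edges with colors in `S`. -/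
abbrev InvariantFun (G : ColoredGraph C V) (S : Set C) (X : Type) : Type :=
  {f : V → X // ∀ c ∈ S, ∀ v, f (G.mate c v) = f v}

/-- Invariant functions are functions on the connected components. -/
def invariantFunEquiv (G : ColoredGraph C V) (S : Set C) (X : Type) :
    G.InvariantFun S X ≃ ((G.restrictColors S).ConnectedComponent → X) where
  toFun f := SimpleGraph.ConnectedComponent.lift f.1 fun _ _ p _ =>
    G.reachable_induction (r := fun v w => f.1 v = f.1 w) (fun _ => rfl)
      (fun _ _ _ => Eq.trans) (fun c hc v => (f.2 c hc v).symm) p.reachable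
  invFun g := ⟨fun v => g ((G.restrictColors S).connectedComponentMk v), fun c hc v => by
    exact congrArg g (SimpleGraph.ConnectedComponent.sound (G.reachable_mate hc v)).symm⟩
  left_inv f := by ext v; rfl
  right_inv g := by
    funext c
    refine SimpleGraph.ConnectedComponent.ind (fun v => ?_) c
    rfl

lemma card_invariantFun (G : ColoredGraph C V) [Finite V] (S : Set C) (X : Type) :
    Nat.card (G.InvariantFun S X) =
      Nat.card X ^ Nat.card (G.restrictColors S).ConnectedComponent := by
  rw [Nat.card_congr (G.invariantFunEquiv S X), Nat.card_fun]

/-- Two-valued invariant functions already determine the number of faces, so face counts are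
compared through bijections of function spaces and never of components. -/
lemma faces_eq_of_card {G : ColoredGraph C V} [Finite V] {c c' : C} {n : ℕ}
    (h : Nat.card (G.InvariantFun {c, c'} (Fin 2)) = 2 ^ n) : G.faces c c' = n := by
  rw [card_invariantFun, Nat.card_fin] at h
  exact Nat.pow_right_injective le_rfl h

lemma card_invariantFun_faces (G : ColoredGraph C V) [Finite V] (c c' : C) (X : Type) :
    Nat.card (G.InvariantFun {c, c'} X) = Nat.card X ^ G.faces c c' :=
  G.card_invariantFun _ X

lemma faces_map [Finite V] [Finite W] (e : V ≃ W) (G : ColoredGraph C V) (c c' : C) :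
    (G.map e).faces c c' = G.faces c c' := by
  refine faces_eq_of_card ?_
  rw [show 2 ^ G.faces c c' = Nat.card (Fin 2) ^ G.faces c c' by simp, ← card_invariantFun_faces]
  refine Nat.card_congr ((e.symm.arrowCongr (Equiv.refl _)).subtypeEquiv fun f => ?_)
  simp only [Equiv.arrowCongr_apply, Equiv.symm_symm, Equiv.coe_refl, Function.comp_apply, id]
  refine forall₂_congr fun c _ => ⟨fun h v => ?_, fun h v => ?_⟩
  · rw [← h (e v), map_mate_apply]
  · simpa [map] using h (e.symm v)

lemma faces_sum [Finite V] [Finite W] (G : ColoredGraph C V) (H : ColoredGraph C W) (c c' : C) :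
    (G.sum H).faces c c' = G.faces c c' + H.faces c c' := by
  refine faces_eq_of_card ?_
  rw [show 2 ^ (G.faces c c' + H.faces c c') = Nat.card (Fin 2) ^ G.faces c c' *
      Nat.card (Fin 2) ^ H.faces c c' by simp [pow_add], ← card_invariantFun_faces,
    ← card_invariantFun_faces, ← Nat.card_prod]
  refine Nat.card_congr (((Equiv.sumArrowEquivProdArrow V W (Fin 2)).subtypeEquiv
    (q := fun x => (∀ d ∈ ({c, c'} : Set C), ∀ v, x.1 (G.mate d v) = x.1 v) ∧
      ∀ d ∈ ({c, c'} : Set C), ∀ v, x.2 (H.mate d v) = x.2 v) fun f => ?_).trans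
    (Equiv.subtypeProdEquivProd
      (p := fun f : V → Fin 2 => ∀ d ∈ ({c, c'} : Set C), ∀ v, f (G.mate d v) = f v)
      (q := fun f : W → Fin 2 => ∀ d ∈ ({c, c'} : Set C), ∀ v, f (H.mate d v) = f v)))
  simp only [Sum.forall, sum_mate_inl, sum_mate_inr]
  exact ⟨fun h => ⟨fun d hd => (h d hd).1, fun d hd => (h d hd).2⟩,
    fun h d hd => ⟨h.1 d hd, h.2 d hd⟩⟩

end ColoredGraph

/-! ### Face factors and sums over the edges of color 0 -/

variable {D : ℕ} {V W : Type}

lemma faceFactor_map [Finite V] [Finite W] (par : Fin D → Fin 2) (N : Fin D → ℤ) (e : V ≃ W)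
    (G : ColoredGraph (Fin (D + 1)) V) : faceFactor par N (G.map e) = faceFactor par N G := by
  simp [faceFactor, ColoredGraph.faces_map]

lemma faceFactor_sum [Finite V] [Finite W] (par : Fin D → Fin 2) (N : Fin D → ℤ)
    (G : ColoredGraph (Fin (D + 1)) V) (H : ColoredGraph (Fin (D + 1)) W) :
    faceFactor par N (G.sum H) = faceFactor par N G * faceFactor par N H := by
  simp [faceFactor, ColoredGraph.faces_sum, pow_add, Finset.prod_mul_distrib]

lemma extends_iff {n : ℕ} (b : Fin n → TraceGraph D)
    (G : ColoredGraph (Fin (D + 1)) (UnionVertex b)) :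
    Extends b G ↔ G.tail = ColoredGraph.sigma fun i => (b i).2 := by
  constructor
  · intro h
    ext1
    funext c x
    exact h c x.1 x.2
  · intro h c i v
    exact congrFun (congrFun (congrArg ColoredGraph.mate h) c) ⟨i, v⟩

open Classical in
/-- The sum of the face factors of all the `(D + 1)`-colored graphs with a given maximal subgraph of
nonzero colors. -/
def extSum [Finite V] (par : Fin D → Fin 2) (N : Fin D → ℤ) (H : ColoredGraph (Fin D) V) : ℤ :=
  ∑ G : ColoredGraph (Fin (D + 1)) V with G.tail = H, faceFactor par N G

lemma extSum_map [Finite V] [Finite W] (par : Fin D → Fin 2) (N : Fin D → ℤ) (e : V ≃ W)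
    (H : ColoredGraph (Fin D) V) : extSum par N (H.map e) = extSum par N H := by
  classical
  symm
  refine Finset.sum_bij' (fun G _ => G.map e) (fun G _ => G.map e.symm) ?_ ?_ ?_ ?_ ?_
  · intro G hG
    simp only [Finset.mem_filter, Finset.mem_univ, true_and] at hG ⊢
    rw [ColoredGraph.tail_map, hG]
  · intro G hG
    simp only [Finset.mem_filter, Finset.mem_univ, true_and] at hG ⊢
    rw [ColoredGraph.tail_map, hG, ColoredGraph.map_symm_map]
  · simp
  · simp
  · intro G _
    rw [faceFactor_map]

/-- Every vertex of `G` is connected to the bubble at position `0`. -/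
def MeetsFirst {n : ℕ} {b : Fin (n + 1) → TraceGraph D}
    (G : ColoredGraph (Fin (D + 1)) (UnionVertex b)) : Prop :=
  ∀ v, ∃ w : Fin (2 * (b 0).1), (G.restrictColors Set.univ).Reachable v ⟨0, w⟩

open Classical in
/-- The sum of the face factors of the graphs all of whose components meet the bubble at
position `0`. -/
def connSum {n : ℕ} (par : Fin D → Fin 2) (N : Fin D → ℤ) (b : Fin (n + 1) → TraceGraph D) : ℤ :=
  ∑ G : ColoredGraph (Fin (D + 1)) (UnionVertex b) with
    G.tail = (ColoredGraph.sigma fun i => (b i).2) ∧ MeetsFirst G, faceFactor par N G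

/-- The bubbles `1, …, n` that are connected to the bubble `0`. -/
def touching {n : ℕ} {b : Fin (n + 1) → TraceGraph D}
    (G : ColoredGraph (Fin (D + 1)) (UnionVertex b)) : Set (Fin n) :=
  {i | ∃ v w, (G.restrictColors Set.univ).Reachable ⟨i.succ, v⟩ ⟨0, w⟩}

/-! ### Splitting off the components that meet the first bubble -/

section Decomposition

variable {n m r : ℕ}

/-- The extension of a partition of the bubbles `1, …, n` in two classes, where the bubble `0` is
added to the first class. -/
def splitIndex (e : Fin m ⊕ Fin r ≃ Fin n) : Fin (m + 1) ⊕ Fin r ≃ Fin (n + 1) where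
  toFun := Sum.elim (Fin.cons 0 fun i => (e (Sum.inl i)).succ) fun j => (e (Sum.inr j)).succ
  invFun := Fin.cons (Sum.inl 0) fun i => Sum.map Fin.succ id (e.symm i)
  left_inv x := by
    rcases x with i | j
    · refine Fin.cases ?_ (fun i => ?_) i <;> simp
    · simp
  right_inv i := by
    refine Fin.cases ?_ (fun i => ?_) i
    · simp
    · have hi := e.apply_symm_apply i
      rcases h : e.symm i with j | j <;> rw [h] at hi <;> simp [h, hi]

/-- The partition of the vertices that is induced by a partition of the bubbles. -/
def splitVertex {ι ι₁ ι₂ : Type} (F : ι → Type) (e : ι₁ ⊕ ι₂ ≃ ι) :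
    (Σ i, F (e (Sum.inl i))) ⊕ (Σ i, F (e (Sum.inr i))) ≃ Σ i, F i :=
  (Equiv.sumSigmaDistrib fun x => F (e x)).symm.trans (Equiv.sigmaCongrLeft (β := F) e)

lemma map_splitVertex_sigma {C ι ι₁ ι₂ : Type} {F : ι → Type} (e : ι₁ ⊕ ι₂ ≃ ι)
    (G : ∀ i, ColoredGraph C (F i)) :
    ((ColoredGraph.sigma fun i => G (e (Sum.inl i))).sum
      (ColoredGraph.sigma fun i => G (e (Sum.inr i)))).map (splitVertex F e) =
      ColoredGraph.sigma G := by
  ext1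
  funext c x
  obtain ⟨y, rfl⟩ := (splitVertex F e).surjective x
  rw [ColoredGraph.map_mate_apply]
  rcases y with ⟨i, v⟩ | ⟨i, v⟩ <;> rfl

/-- Paths in a bubble are paths in the whole graph, so a connected bubble lies in a single
component. -/
lemma reachable_bubble {n : ℕ} {b : Fin n → TraceGraph D}
    {G : ColoredGraph (Fin (D + 1)) (UnionVertex b)}
    (hG : G.tail = ColoredGraph.sigma fun i => (b i).2) {i : Fin n} (hb : (b i).2.Connected)
    (v w : Fin (2 * (b i).1)) : (G.restrictColors Set.univ).Reachable ⟨i, v⟩ ⟨i, w⟩ := by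
  refine (b i).2.reachable_induction (S := Set.univ)
    (r := fun v w => (G.restrictColors Set.univ).Reachable ⟨i, v⟩ ⟨i, w⟩)
    (fun _ => .refl _) (fun _ _ _ => .trans) (fun c _ v => ?_) (hb.preconnected v w)
  have h := congrFun (congrFun (congrArg ColoredGraph.mate hG) c) ⟨i, v⟩
  rw [ColoredGraph.sigma_mate, ColoredGraph.tail_mate] at h
  rw [← h]
  exact G.reachable_mate (Set.mem_univ _) _

-- No edge joins a component meeting bubble `0` to one that does not, and connected bubbles lie
-- entirely on one side. So prescribing the touching bubbles is the same as choosing independently a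
-- graph on the first class that meets bubble `0` and an arbitrary graph on the second; face factors
-- multiply.
open Classical in
lemma sum_touching_eq (par : Fin D → Fin 2) (N : Fin D → ℤ) (b : Fin (n + 1) → TraceGraph D)
    (hb : ∀ i : Fin n, (b i.succ).2.Connected) (e : Fin m ⊕ Fin r ≃ Fin n) :
    ∑ G : ColoredGraph (Fin (D + 1)) (UnionVertex b) with
      G.tail = (ColoredGraph.sigma fun i => (b i).2) ∧
        touching G = Set.range fun i => e (Sum.inl i), faceFactor par N G =
    connSum par N (fun i => b (splitIndex e (Sum.inl i))) *
      extSum par N (ColoredGraph.sigma fun i => (b (splitIndex e (Sum.inr i))).2) := by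
  rw [connSum, extSum, Finset.sum_mul_sum, ← Finset.sum_product']
  symm
  set u := splitVertex (fun i => Fin (2 * (b i).1)) (splitIndex e) with hu
  have hu0 : ∀ w : Fin (2 * (b 0).1), u (Sum.inl ⟨0, w⟩) = ⟨0, w⟩ := fun _ => rfl
  -- The second summand is closed under all edges, so its bubbles cannot reach bubble `0`.
  have closed_right : ∀ (G₁ G₂) {v w},
      (((ColoredGraph.sum (C := Fin (D + 1)) G₁ G₂).map u).restrictColors Set.univ).Reachable v w →
      (∃ x, v = u (Sum.inr x)) → ∃ x, w = u (Sum.inr x) := by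
    intro G₁ G₂ v w h
    refine ColoredGraph.reachable_closed _ (p := fun v => ∃ x, v = u (Sum.inr x)) ?_ h
    rintro c - _ ⟨x, rfl⟩
    exact ⟨G₂.mate c x, by rw [ColoredGraph.map_mate_apply, ColoredGraph.sum_mate_inr]⟩
  have reach_left : ∀ (G₁ G₂) {v w}, (ColoredGraph.restrictColors G₁ Set.univ).Reachable v w →
      (((ColoredGraph.sum (C := Fin (D + 1)) G₁ G₂).map u).restrictColors Set.univ).Reachable
        (u (Sum.inl v)) (u (Sum.inl w)) := by
    intro G₁ G₂ v w h
    refine G₁.reachable_hom _ (fun v => u (Sum.inl v)) (fun c _ v => ?_) h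
    rw [ColoredGraph.map_mate_apply, ColoredGraph.sum_mate_inl]
  refine Finset.sum_bij (fun G _ => (G.1.sum G.2).map u) ?_ ?_ ?_ ?_
  · rintro ⟨G₁, G₂⟩ hG
    simp only [Finset.mem_product, Finset.mem_filter, Finset.mem_univ, true_and] at hG ⊢
    obtain ⟨⟨h1, hmeet⟩, h2⟩ := hG
    refine ⟨?_, ?_⟩
    · rw [ColoredGraph.tail_map, ColoredGraph.tail_sum, h1, h2]
      exact map_splitVertex_sigma (splitIndex e) fun i => (b i).2
    · ext i
      obtain ⟨x, rfl⟩ := e.surjective i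
      rcases x with i | i
      · simp only [Set.mem_range, exists_apply_eq_apply, iff_true]
        -- Nonemptiness matters here: a bubble without vertices would meet the condition vacuously
        -- and yet touch nothing.
        obtain ⟨v⟩ := (hb (e (Sum.inl i))).nonempty
        obtain ⟨w, hw⟩ := hmeet ⟨i.succ, v⟩
        exact ⟨v, w, reach_left G₁ G₂ hw⟩
      · simp only [Set.mem_range, EmbeddingLike.apply_eq_iff_eq, reduceCtorEq, exists_false,
          iff_false]
        rintro ⟨v, w, h⟩
        obtain ⟨x, hx⟩ := closed_right G₁ G₂ h ⟨⟨i, v⟩, rfl⟩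
        rw [← hu0, u.apply_eq_iff_eq] at hx
        simp at hx
  · rintro ⟨G₁, G₂⟩ - ⟨G₃, G₄⟩ - h
    have h := ColoredGraph.map_injective u h
    have hm := fun c x => congrFun (congrFun (congrArg ColoredGraph.mate h) c) x
    refine Prod.ext ?_ ?_
    · ext c x : 3
      exact Sum.inl_injective (hm c (Sum.inl x))
    · ext c x : 3
      exact Sum.inr_injective (hm c (Sum.inr x))
  · intro G hG
    simp only [Finset.mem_filter, Finset.mem_univ, true_and] at hG
    obtain ⟨htail, htouch⟩ := hG
    -- The side of a vertex is characterized by reachability of bubble `0`, which edges preserve;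
    -- hence every `mate` restricts to each side.
    have hreach : ∀ x, (∃ w, (G.restrictColors Set.univ).Reachable (u x) ⟨0, w⟩) ↔
        x.isLeft = true := by
      rintro (⟨i, x⟩ | ⟨i, x⟩)
      · simp only [Sum.isLeft_inl, iff_true]
        induction i using Fin.cases with
        | zero => exact ⟨x, .refl _⟩
        | succ i =>
          have hi : e (Sum.inl i) ∈ touching G := htouch ▸ ⟨i, rfl⟩
          obtain ⟨v, w, hvw⟩ := hi
          exact ⟨w, (reachable_bubble htail (hb _) x v).trans hvw⟩
      · simp only [Sum.isLeft_inr, Bool.false_eq_true, iff_false]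
        rintro ⟨w, hw⟩
        have hi : e (Sum.inr i) ∈ touching G := ⟨x, w, hw⟩
        rw [htouch] at hi
        simp at hi
    set G' := G.map u.symm with hG'
    have hGG' : G'.map u = G := ColoredGraph.map_map_symm u G
    have hside : ∀ c x, (G'.mate c x).isLeft = x.isLeft := by
      intro c x
      rw [Bool.eq_iff_iff, ← hreach, ← hreach, ← ColoredGraph.map_mate_apply, hGG']
      have h := G.reachable_mate (Set.mem_univ c) (u x)
      exact ⟨fun ⟨w, hw⟩ => ⟨w, h.trans hw⟩, fun ⟨w, hw⟩ => ⟨w, h.symm.trans hw⟩⟩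
    have hl : ∀ c v, ∃ v', G'.mate c (Sum.inl v) = Sum.inl v' := fun c v =>
      Sum.isLeft_iff.1 (hside c (Sum.inl v))
    have hr : ∀ c v, ∃ v', G'.mate c (Sum.inr v) = Sum.inr v' := fun c v => by
      have := hside c (Sum.inr v)
      exact Sum.isRight_iff.1 (by rw [← Sum.not_isLeft, this, Sum.not_isLeft]; exact rfl)
    choose l hl using hl
    choose r hr using hr
    let G₁ : ColoredGraph (Fin (D + 1)) _ :=
      { mate := l
        mate_mate := fun c v => Sum.inl_injective
          (β := Σ i, Fin (2 * (b (splitIndex e (Sum.inr i))).1))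
          (by rw [← hl, ← hl, G'.mate_mate])
        mate_ne := fun c v h => G'.mate_ne c (Sum.inl v) (by rw [hl, h]) }
    let G₂ : ColoredGraph (Fin (D + 1)) _ :=
      { mate := r
        mate_mate := fun c v => Sum.inr_injective
          (α := Σ i, Fin (2 * (b (splitIndex e (Sum.inl i))).1))
          (by rw [← hr, ← hr, G'.mate_mate])
        mate_ne := fun c v h => G'.mate_ne c (Sum.inr v) (by rw [hr, h]) }
    have hsum : G₁.sum G₂ = G' := by
      ext1
      funext c x
      rcases x with x | x
      · exact (hl c x).symm
      · exact (hr c x).symm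
    have htail' : G'.tail = (ColoredGraph.sigma fun i => (b (splitIndex e (Sum.inl i))).2).sum
        (ColoredGraph.sigma fun i => (b (splitIndex e (Sum.inr i))).2) := by
      apply ColoredGraph.map_injective u
      rw [← ColoredGraph.tail_map, hGG', htail]
      exact (map_splitVertex_sigma (splitIndex e) fun i => (b i).2).symm
    rw [← hsum, ColoredGraph.tail_sum] at htail'
    have hm := fun c x => congrFun (congrFun (congrArg ColoredGraph.mate htail') c) x
    refine ⟨(G₁, G₂), ?_, by rw [hsum, hGG']⟩
    simp only [Finset.mem_product, Finset.mem_filter, Finset.mem_univ, true_and]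
    refine ⟨⟨?_, ?_⟩, ?_⟩
    · ext c x : 3
      exact Sum.inl_injective (hm c (Sum.inl x))
    · intro v
      obtain ⟨w, hw⟩ := (hreach (Sum.inl v)).2 rfl
      refine ⟨w, ?_⟩
      have h := G.reachable_hom G' u.symm (S := Set.univ)
        (fun c _ v => by rw [hG', ColoredGraph.map_mate_apply]) hw
      rw [← hu0, Equiv.symm_apply_apply, Equiv.symm_apply_apply, ← hsum] at h
      -- A path that starts on the left stays there; the invariant records in addition that it is a
      -- path of `G₁`.
      obtain ⟨w', hw', hvw'⟩ := ColoredGraph.reachable_closed _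
        (p := fun y => ∃ v', y = Sum.inl v' ∧ (G₁.restrictColors Set.univ).Reachable v v') (by
          rintro c hc _ ⟨v', rfl, hv'⟩
          exact ⟨_, rfl, hv'.trans (G₁.reachable_mate hc v')⟩) h ⟨v, rfl, .refl _⟩
      rw [Sum.inl_injective hw']
      exact hvw'
    · ext c x : 3
      exact Sum.inr_injective (hm c (Sum.inr x))
  · rintro ⟨G₁, G₂⟩ -
    rw [faceFactor_map, faceFactor_sum]

/-- Every graph is the disjoint union of the components that meet the bubble `0`, and the others. -/
theorem extSum_eq_sum_split (par : Fin D → Fin 2) (N : Fin D → ℤ) (b : Fin (n + 1) → TraceGraph D)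
    (hb : ∀ i : Fin n, (b i.succ).2.Connected) :
    extSum par N (ColoredGraph.sigma fun i => (b i).2) =
      ∑ S : Finset (Fin n),
        connSum par N (fun i => b (splitIndex (finSumEquivOfFinset rfl rfl :
          Fin S.card ⊕ Fin Sᶜ.card ≃ Fin n) (Sum.inl i))) *
        extSum par N (ColoredGraph.sigma fun i => (b (splitIndex (finSumEquivOfFinset rfl rfl :
          Fin S.card ⊕ Fin Sᶜ.card ≃ Fin n) (Sum.inr i))).2) := by
  classical
  rw [extSum, ← Finset.sum_fiberwise _ (fun G => (touching G).toFinset)]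
  refine Finset.sum_congr rfl fun S _ => ?_
  rw [← sum_touching_eq par N b hb, Finset.filter_filter]
  refine Finset.sum_congr (Finset.filter_congr fun G _ => and_congr_right fun _ => ?_) fun _ _ => rfl
  have : (Set.range fun i => (finSumEquivOfFinset rfl rfl :
      Fin S.card ⊕ Fin Sᶜ.card ≃ Fin n) (Sum.inl i)) = (S : Set (Fin n)) := by
    ext i
    simp only [finSumEquivOfFinset_inl, Set.mem_range, SetLike.mem_coe]
    rw [← Set.mem_range, Finset.range_orderEmbOfFin]
    simp
  rw [this, ← Finset.coe_inj, Set.coe_toFinset]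

end Decomposition

/-! ### The contribution of the faces of two colors -/

/-- The number of cycles of a permutation, including the fixed points, determines its sign. -/
lemma sign_eq_neg_one_pow_orbits {α : Type} [Fintype α] [DecidableEq α] (f : Equiv.Perm α) :
    Equiv.Perm.sign f =
      (-1) ^ (Fintype.card α + Nat.card (Quotient (Equiv.Perm.SameCycle.setoid f))) := by
  classical
  have h : Nat.card (Quotient (Equiv.Perm.SameCycle.setoid f)) =
      f.cycleType.card + (Fintype.card α - f.support.card) := by
    -- `cycleType` omits fixed points, so an orbit is encoded either by its cycle factor or by its
    -- fixed point.
    let F : α → f.cycleFactorsFinset ⊕ (f.supportᶜ : Finset α) := fun x =>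
      if hx : f x = x then Sum.inr ⟨x, by simpa using hx⟩
      else Sum.inl ⟨f.cycleOf x, Equiv.Perm.cycleOf_mem_cycleFactorsFinset_iff.2 (by simpa using hx)⟩
    have hF : ∀ x y, F x = F y ↔ f.SameCycle x y := by
      intro x y
      by_cases hx : f x = x
      · by_cases hy : f y = y
        · simp only [F, hx, hy, dif_pos, Sum.inr.injEq, Subtype.mk.injEq]
          exact ⟨fun h => h ▸ .refl _ _, fun h => h.eq_of_left hx⟩
        · simp only [F, hx, hy, dif_pos, dif_neg, not_false_eq_true, reduceCtorEq, false_iff]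
          intro h
          exact hy (h.eq_of_left hx ▸ hx)
      · by_cases hy : f y = y
        · simp only [F, hx, hy, dif_pos, dif_neg, not_false_eq_true, reduceCtorEq, false_iff]
          intro h
          exact hx ((h.eq_of_right hy).symm ▸ hy)
        · simp only [F, hx, hy, dif_neg, not_false_eq_true, Sum.inl.injEq, Subtype.mk.injEq]
          exact (Equiv.Perm.sameCycle_iff_cycleOf_eq_of_mem_support (by simpa using hx)
            (by simpa using hy)).symm
    have hsurj : Function.Surjective F := by
      rintro (⟨c, hc⟩ | ⟨x, hx⟩)
      · obtain ⟨x, hx⟩ := (Equiv.Perm.mem_cycleFactorsFinset_iff.1 hc).1.nonempty_support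
        have hfx := Equiv.Perm.mem_support.1 (Equiv.Perm.mem_cycleFactorsFinset_support_le hc hx)
        refine ⟨x, ?_⟩
        simp only [F, hfx, dif_neg, not_false_eq_true, Sum.inl.injEq, Subtype.mk.injEq]
        exact (Equiv.Perm.cycle_is_cycleOf hx hc).symm
      · have : f x = x := by simpa using hx
        exact ⟨x, by simp [F, this]⟩
    have e : Quotient (Equiv.Perm.SameCycle.setoid f) ≃
        f.cycleFactorsFinset ⊕ (f.supportᶜ : Finset α) :=
      Equiv.ofBijective (Quotient.lift F fun x y h => (hF x y).2 h)
        ⟨by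
          rintro ⟨x⟩ ⟨y⟩ hxy
          exact Quotient.sound ((hF x y).1 hxy), fun z => by
          obtain ⟨x, rfl⟩ := hsurj z
          exact ⟨Quotient.mk _ x, rfl⟩⟩
    rw [Nat.card_congr e, Nat.card_sum, Nat.card_eq_fintype_card, Nat.card_eq_fintype_card,
      Fintype.card_coe, Fintype.card_coe, Finset.card_compl, Equiv.Perm.cycleType_def]
    simp
  rw [Equiv.Perm.sign_of_cycleType, h, Equiv.Perm.sum_cycleType]
  have hle := Finset.card_le_univ f.support
  obtain ⟨d, hd⟩ := Nat.exists_eq_add_of_le hle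
  -- A fixed point counts once as an element and once as an orbit, so it does not affect the parity.
  rw [hd, show f.support.card + d + (f.cycleType.card + (f.support.card + d - f.support.card)) =
    (f.support.card + f.cycleType.card) + 2 * d by omega, pow_add _ _ (2 * d), pow_mul]
  simp

lemma card_invariant_perm {α X : Type} [Finite α] (f : Equiv.Perm α) :
    Nat.card {x : α → X // ∀ l, x (f l) = x l} =
      Nat.card X ^ Nat.card (Quotient (Equiv.Perm.SameCycle.setoid f)) := by
  rw [← Nat.card_fun]
  refine Nat.card_congr
    { toFun := fun x => Quotient.lift x.1 ?_
      invFun := fun y => ⟨fun l => y (Quotient.mk _ l), fun l => congrArg y (Quotient.sound ?_)⟩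
      left_inv := fun x => rfl
      right_inv := fun y => funext fun q => Quotient.inductionOn q fun _ => rfl }
  · rintro a b ⟨m, rfl⟩
    have hinv : ∀ l, x.1 (f⁻¹ l) = x.1 l := fun l => by
      rw [← x.2 (f⁻¹ l), Equiv.Perm.inv_def, Equiv.apply_symm_apply]
    induction m using Int.induction_on with
    | zero => rfl
    | succ i ih => rw [ih, add_comm, zpow_add, zpow_one, Equiv.Perm.mul_apply, x.2]
    | pred i ih => rw [ih, sub_eq_add_neg, add_comm, zpow_add, zpow_neg_one, Equiv.Perm.mul_apply,
        hinv]
  · exact ⟨-1, by simp⟩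

/-- The cycles that alternate between two colors have even length. -/
lemma exists_alternating {C V : Type} (G : ColoredGraph C V) (c c' : C) :
    ∃ h : V → Fin 2, ∀ v, h (G.mate c v) = h v + 1 ∧ h (G.mate c' v) = h v + 1 := by
  classical
  let π : Equiv.Perm V := Function.Involutive.toPerm (G.mate c) (G.mate_mate c)
  let ρ : Equiv.Perm V := Function.Involutive.toPerm (G.mate c') (G.mate_mate c')
  have hπ : ∀ v, π v = G.mate c v := fun _ => rfl
  have hρ : ∀ v, ρ v = G.mate c' v := fun _ => rfl
  have hπ2 : ∀ v, π (π v) = v := G.mate_mate c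
  have hρ2 : ∀ v, ρ (ρ v) = v := G.mate_mate c'
  have hπi : π⁻¹ = π := by ext v; rw [Equiv.Perm.inv_eq_iff_eq, hπ2]
  let τ := ρ * π
  have hτ : ∀ v, τ v = ρ (π v) := fun _ => rfl
  have hτi : π * τ * π⁻¹ = τ⁻¹ := by
    rw [mul_inv_eq_iff_eq_mul]
    ext v
    rw [Equiv.Perm.mul_apply, show (τ⁻¹ * π) v = τ⁻¹ (π v) from rfl, Equiv.Perm.eq_inv_iff_eq, hτ, hτ, hπ2, hρ2]
  have hcomm : ∀ (m : ℤ) v, π ((τ ^ m) v) = (τ ^ (-m)) (π v) := by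
    intro m v
    have h : π * τ ^ m * π⁻¹ = τ ^ (-m) := by rw [← conj_zpow, hτi, inv_zpow, zpow_neg]
    rw [← h, hπi]
    simp [hπ2]
  -- `π` reverses the cycles of `τ = ρπ`. If it mapped such a cycle to itself, the reflection would
  -- have a fixed midpoint: a fixed point of `π` when the distance `m` is even, of `ρ` when it is
  -- odd.
  have hnot : ∀ v, ¬ τ.SameCycle v (π v) := by
    rintro v ⟨m, hm⟩
    rcases Int.even_or_odd' m with ⟨j, rfl | rfl⟩
    · refine G.mate_ne c ((τ ^ j) v) ?_
      rw [← hπ, hcomm, ← hm, ← Equiv.Perm.mul_apply, ← zpow_add]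
      congr 2
      ring
    · refine G.mate_ne c' ((τ ^ (j + 1)) v) ?_
      have h : ρ ((τ ^ (j + 1)) v) = τ (π ((τ ^ (j + 1)) v)) := by rw [hτ, hπ2]
      rw [← hρ, h, hcomm, ← hm, ← Equiv.Perm.mul_apply, ← Equiv.Perm.mul_apply, mul_assoc,
        ← zpow_add, ← zpow_one_add]
      congr 2
      ring
  let r : V → V := fun v =>
    (Quot.out ((G.restrictColors {c, c'}).connectedComponentMk v))
  have hr : ∀ v w, (G.restrictColors {c, c'}).Reachable v w → r v = r w := fun v w h => by
    simp only [r, SimpleGraph.ConnectedComponent.sound h]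
  -- A face consists of two cycles of `τ` exchanged by `π`; the coloring distinguishes the one that
  -- contains the chosen representative `r v`.
  have hor : ∀ v, τ.SameCycle (r v) v ∨ τ.SameCycle (r v) (π v) := by
    intro v
    have hv : (G.restrictColors {c, c'}).Reachable (r v) v :=
      SimpleGraph.ConnectedComponent.exact (Quot.out_eq _)
    refine G.reachable_closed (p := fun w => τ.SameCycle (r v) w ∨ τ.SameCycle (r v) (π w)) ?_ hv
      (Or.inl (.refl _ _))
    rintro d (rfl | rfl) w hw
    · rw [← hπ, hπ2]
      exact hw.symm
    · have h1 : ρ w = τ (π w) := by rw [hτ, hπ2]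
      have h2 : w = τ (π (ρ w)) := by rw [hτ, hπ2, hρ2]
      rcases hw with hw | hw
      · right
        rw [h2, Equiv.Perm.sameCycle_apply_right] at hw
        exact hw
      · left
        rw [← hρ, h1, Equiv.Perm.sameCycle_apply_right]
        exact hw
  refine ⟨fun v => if τ.SameCycle (r v) v then 0 else 1, fun v => ?_⟩
  have key : ∀ v, (τ.SameCycle (r v) (π v) ↔ ¬ τ.SameCycle (r v) v) := fun v =>
    ⟨fun h h' => hnot v (h'.symm.trans h), fun h => (hor v).resolve_left h⟩
  have e1 : r (G.mate c v) = r v := (hr _ _ (G.reachable_mate (by simp) v)).symm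
  have e2 : r (G.mate c' v) = r v := (hr _ _ (G.reachable_mate (by simp) v)).symm
  have e3 : τ.SameCycle (r v) (G.mate c' v) ↔ τ.SameCycle (r v) (π v) := by
    have h1 : ρ v = τ (π v) := by rw [hτ, hπ2]
    rw [← hρ, h1, Equiv.Perm.sameCycle_apply_right]
  rw [← hπ] at e1
  simp only [← hπ, e1, e2, e3, key]
  by_cases h : τ.SameCycle (r v) v <;> simp [h]

section FaceSum

variable {ι V X : Type} [Fintype ι] [DecidableEq ι] [Fintype V] [DecidableEq V] [Fintype X]

/-- The other end of an edge of a directed pairing. -/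
def pairMate (E : ι × Fin 2 ≃ V) (v : V) : V := E ((E.symm v).1, (E.symm v).2 + 1)

/-- The contraction of the tensors `g` along the directed edges of two pairings, with the sign. -/
def faceSum (p : ℕ) (g : Matrix X X ℂ) (P E : ι × Fin 2 ≃ V) : ℂ :=
  ((Equiv.Perm.sign (P.symm.trans E) : ℤ) : ℂ) ^ p *
    ∑ a : V → X, (∏ l, g (a (E (l, 0))) (a (E (l, 1)))) * ∏ l, g (a (P (l, 1))) (a (P (l, 0)))

/-- Reverse the directions of some edges. -/
def flipPairs (φ : ι → Fin 2) : Equiv.Perm (ι × Fin 2) :=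
  Equiv.prodCongrRight fun l => Equiv.addRight (φ l)

@[simp] lemma flipPairs_apply (φ : ι → Fin 2) (l : ι) (e : Fin 2) :
    flipPairs φ (l, e) = (l, e + φ l) := rfl

lemma pairMate_flipPairs (φ : ι → Fin 2) (E : ι × Fin 2 ≃ V) :
    pairMate ((flipPairs φ).trans E) = pairMate E := by
  funext v
  obtain ⟨⟨l, e⟩, rfl⟩ := ((flipPairs φ).trans E).surjective v
  simp only [pairMate, Equiv.symm_apply_apply]
  simp [add_right_comm]

lemma sign_addRight_fin_two (x : Fin 2) :
    Equiv.Perm.sign (Equiv.addRight x) = (-1) ^ (x : ℕ) := by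
  revert x
  decide

lemma apply_flip {p : ℕ} {g : Matrix X X ℂ} (hg : ∀ a b, g b a = (-1) ^ p * g a b) (x : Fin 2)
    (a : Fin 2 → X) : g (a (0 + x)) (a (1 + x)) = ((-1) ^ (x : ℕ)) ^ p * g (a 0) (a 1) := by
  fin_cases x
  · simp
  · simpa using hg (a 0) (a 1)

lemma apply_flip' {p : ℕ} {g : Matrix X X ℂ} (hg : ∀ a b, g b a = (-1) ^ p * g a b) (x : Fin 2)
    (a : Fin 2 → X) : g (a (1 + x)) (a (0 + x)) = ((-1) ^ (x : ℕ)) ^ p * g (a 1) (a 0) := by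
  fin_cases x
  · simp
  · simpa using hg (a 1) (a 0)

lemma sign_sq_pow (s : ℤˣ) (p : ℕ) : ((s : ℤ) : ℂ) ^ p * ((s : ℤ) : ℂ) ^ p = 1 := by
  rcases Int.units_eq_one_or s with rfl | rfl <;> simp [← mul_pow]

/-- Each reversed edge is a transposition in the relative sign and an exchange of arguments in `g`;
both give `(-1)^p`. -/
lemma faceSum_flip_right {p : ℕ} {g : Matrix X X ℂ} (hg : ∀ a b, g b a = (-1) ^ p * g a b)
    (φ : ι → Fin 2) (P E : ι × Fin 2 ≃ V) :
    faceSum p g P ((flipPairs φ).trans E) = faceSum p g P E := by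
  have hs : Equiv.Perm.sign (P.symm.trans ((flipPairs φ).trans E)) =
      (∏ l, (-1) ^ (φ l : ℕ)) * Equiv.Perm.sign (P.symm.trans E) := by
    have : P.symm.trans ((flipPairs φ).trans E) =
        ((P.symm.trans (flipPairs φ)).trans P).trans (P.symm.trans E) := by
      ext; simp
    rw [this, Equiv.Perm.sign_trans, Equiv.Perm.sign_symm_trans_trans, flipPairs,
      Equiv.Perm.sign_prodCongrRight, mul_comm]
    simp_rw [sign_addRight_fin_two]
  have hprod : ∀ a : V → X, ∏ l, g (a (((flipPairs φ).trans E) (l, 0)))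
      (a (((flipPairs φ).trans E) (l, 1))) =
      (((∏ l, (-1) ^ (φ l : ℕ) : ℤˣ) : ℤ) : ℂ) ^ p * ∏ l, g (a (E (l, 0))) (a (E (l, 1))) := by
    intro a
    push_cast
    rw [← Finset.prod_pow, ← Finset.prod_mul_distrib]
    refine Finset.prod_congr rfl fun l _ => ?_
    exact apply_flip hg (φ l) fun e => a (E (l, e))
  simp_rw [faceSum, hprod, hs, mul_assoc, ← Finset.mul_sum, ← mul_assoc]
  congr 1
  rw [Units.val_mul, Int.cast_mul, mul_pow, mul_right_comm, sign_sq_pow, one_mul]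

lemma faceSum_flip_left {p : ℕ} {g : Matrix X X ℂ} (hg : ∀ a b, g b a = (-1) ^ p * g a b)
    (φ : ι → Fin 2) (P E : ι × Fin 2 ≃ V) :
    faceSum p g ((flipPairs φ).trans P) E = faceSum p g P E := by
  have hs : Equiv.Perm.sign (((flipPairs φ).trans P).symm.trans E) =
      (∏ l, (-1) ^ (φ l : ℕ)) * Equiv.Perm.sign (P.symm.trans E) := by
    have : ((flipPairs φ).trans P).symm.trans E =
        ((P.symm.trans (flipPairs φ).symm).trans P).trans (P.symm.trans E) := by
      ext; simp
    rw [this, Equiv.Perm.sign_trans, Equiv.Perm.sign_symm_trans_trans, Equiv.Perm.sign_symm,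
      flipPairs, Equiv.Perm.sign_prodCongrRight, mul_comm]
    simp_rw [sign_addRight_fin_two]
  have hprod : ∀ a : V → X, ∏ l, g (a (((flipPairs φ).trans P) (l, 1)))
      (a (((flipPairs φ).trans P) (l, 0))) =
      (((∏ l, (-1) ^ (φ l : ℕ) : ℤˣ) : ℤ) : ℂ) ^ p * ∏ l, g (a (P (l, 1))) (a (P (l, 0))) := by
    intro a
    push_cast
    rw [← Finset.prod_pow, ← Finset.prod_mul_distrib]
    refine Finset.prod_congr rfl fun l _ => ?_
    exact apply_flip' hg (φ l) fun e => a (P (l, e))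
  simp_rw [faceSum, hprod, hs, mul_left_comm _ ((Int.cast _ : ℂ) ^ p), ← Finset.mul_sum,
    ← mul_assoc]
  congr 1
  rw [Units.val_mul, Int.cast_mul, mul_pow, mul_right_comm, sign_sq_pow, one_mul]

/-- Pairings whose edges are directed from the vertices of the first class to those of the second
class of an alternating coloring. -/
lemma faceSum_aligned [DecidableEq X] {C : Type} (p : ℕ) (g : Matrix X X ℂ)
    (hg2 : g * g = (-1 : ℂ) ^ p • 1)
    (P E : ι × Fin 2 ≃ V) (h : V → Fin 2) (hP : ∀ l e, h (P (l, e)) = e)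
    (hE : ∀ l e, h (E (l, e)) = e) (G : ColoredGraph C V) {c c' : C}
    (hc : G.mate c = pairMate E) (hc' : G.mate c' = pairMate P) :
    faceSum p g P E = ((-1) ^ p * (Fintype.card X : ℂ)) ^ G.faces c c' := by
  have hPs : ∀ v, P ((P.symm v).1, h v) = v := fun v => by
    obtain ⟨⟨l, e⟩, rfl⟩ := P.surjective v
    simp [hP]
  have hEs : ∀ v, E ((E.symm v).1, h v) = v := fun v => by
    obtain ⟨⟨l, e⟩, rfl⟩ := E.surjective v
    simp [hE]
  -- Aligned pairings match within each class: `β e` sends an `E`-pair to the `P`-pair that shares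
  -- its vertex of class `e`.
  let β : Fin 2 → Equiv.Perm ι := fun e =>
    { toFun := fun l => (P.symm (E (l, e))).1
      invFun := fun l => (E.symm (P (l, e))).1
      left_inv := fun l => by
        have := hPs (E (l, e))
        rw [hE] at this
        simp [this]
      right_inv := fun l => by
        have := hEs (P (l, e))
        rw [hP] at this
        simp [this] }
  have hβ : ∀ l e, E (l, e) = P (β e l, e) := fun l e => by
    have := hPs (E (l, e))
    rw [hE] at this
    exact this.symm
  -- Going from one `P`-pair to the next across an `E`-edge, starting at the vertex of class `1`;
  -- the cycles of `γ` are the faces.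
  let γ : Equiv.Perm ι := (β 1).symm.trans (β 0)
  have hsign : Equiv.Perm.sign (P.symm.trans E) = Equiv.Perm.sign γ := by
    have : P.symm.trans E = (P.symm.trans (Equiv.prodCongrLeft β)).trans P := by
      ext v
      obtain ⟨⟨l, e⟩, rfl⟩ := P.surjective v
      simp [hβ]
    rw [this, Equiv.Perm.sign_symm_trans_trans, Equiv.Perm.sign_prodCongrLeft]
    simp [γ]
  -- An invariant function is a function of the `P`-pair, and the `E`-edges then impose invariance
  -- under `γ`.
  have hinv : ∀ Y : Type, Nat.card (G.InvariantFun {c, c'} Y) =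
      Nat.card {x : ι → Y // ∀ l, x (γ l) = x l} := by
    intro Y
    refine Nat.card_congr
      { toFun := fun f => ⟨fun l => f.1 (P (l, 0)), fun l => ?_⟩
        invFun := fun x => ⟨fun v => x.1 (P.symm v).1, ?_⟩
        left_inv := fun f => ?_
        right_inv := fun x => by ext l; simp }
    · obtain ⟨l, rfl⟩ := (β 1).surjective l
      have h1 : f.1 (E (l, 1)) = f.1 (E (l, 0)) := by
        rw [← f.2 c (by simp) (E (l, 0)), hc]
        simp [pairMate]
      have h2 : f.1 (P (β 1 l, 1)) = f.1 (P (β 1 l, 0)) := by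
        rw [← f.2 c' (by simp) (P (β 1 l, 0)), hc']
        simp [pairMate]
      simp only [γ, Equiv.trans_apply, Equiv.symm_apply_apply]
      rw [← hβ, ← h1, hβ, h2]
    · rintro d (rfl | rfl) v
      · have h01 : ∀ l, x.1 (β 0 l) = x.1 (β 1 l) := fun l => by
          have := x.2 (β 1 l)
          simpa [γ] using this
        obtain ⟨⟨l, e⟩, rfl⟩ := E.surjective v
        rw [hc]
        simp only [pairMate, Equiv.symm_apply_apply]
        rw [hβ, hβ, Equiv.symm_apply_apply, Equiv.symm_apply_apply]
        fin_cases e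
        · exact (h01 l).symm
        · exact h01 l
      · simp [hc', pairMate]
    · ext v
      obtain ⟨⟨l, e⟩, rfl⟩ := P.surjective v
      simp only [Equiv.symm_apply_apply]
      fin_cases e
      · rfl
      · rw [← f.2 c' (by simp), hc']
        simp [pairMate]
  have hfaces : G.faces c c' = Nat.card (Quotient (Equiv.Perm.SameCycle.setoid γ)) := by
    refine ColoredGraph.faces_eq_of_card ?_
    rw [hinv, card_invariant_perm, Nat.card_fin]
  have hsum : ∑ a : V → X, (∏ l, g (a (E (l, 0))) (a (E (l, 1)))) *
      ∏ l, g (a (P (l, 1))) (a (P (l, 0))) =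
      ((-1) ^ p) ^ Fintype.card ι * (Fintype.card X : ℂ) ^ G.faces c c' := by
    let u : (ι → X) × (ι → X) ≃ (V → X) :=
      ((finTwoArrowEquiv (ι → X)).symm.trans (Equiv.piComm fun _ _ => X)).trans
        ((Equiv.curry ι (Fin 2) X).symm.trans (P.arrowCongr (Equiv.refl X)))
    have hu0 : ∀ x y l, u (x, y) (P (l, 0)) = x l := fun x y l => by
      simp [u, Equiv.arrowCongr, finTwoArrowEquiv, Equiv.piComm, Function.uncurry]
    have hu1 : ∀ x y l, u (x, y) (P (l, 1)) = y l := fun x y l => by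
      simp [u, Equiv.arrowCongr, finTwoArrowEquiv, Equiv.piComm, Function.uncurry]
    rw [← u.sum_comp, Fintype.sum_prod_type]
    -- The sum over the class `1` indices `y` contracts `g * g = (-1)^p` and so forces `x ∘ γ = x`.
    have h1 : ∀ x : ι → X, ∑ y : ι → X,
        (∏ l, g (u (x, y) (E (l, 0))) (u (x, y) (E (l, 1)))) *
          ∏ l, g (u (x, y) (P (l, 1))) (u (x, y) (P (l, 0))) =
        if ∀ l, x (γ l) = x l then ((-1) ^ p) ^ Fintype.card ι else 0 := by
      intro x
      have h2 : ∀ y : ι → X, (∏ l, g (u (x, y) (E (l, 0))) (u (x, y) (E (l, 1)))) *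
          ∏ l, g (u (x, y) (P (l, 1))) (u (x, y) (P (l, 0))) =
          ∏ l, g (x (γ l)) (y l) * g (y l) (x l) := by
        intro y
        rw [Finset.prod_mul_distrib]
        simp only [hβ, hu0, hu1]
        congr 1
        rw [← Equiv.prod_comp (β 1) fun l => g (x (γ l)) (y l)]
        simp [γ]
      simp_rw [h2]
      rw [← Fintype.piFinset_univ, ← Finset.prod_univ_sum (fun _ => Finset.univ)
        fun l z => g (x (γ l)) z * g z (x l)]
      simp_rw [← Matrix.mul_apply, hg2]
      simp only [Matrix.smul_apply, Matrix.one_apply, smul_eq_mul, mul_ite, mul_one, mul_zero]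
      split_ifs with hx
      · simp [hx]
      · push Not at hx
        obtain ⟨l, hl⟩ := hx
        exact Finset.prod_eq_zero (Finset.mem_univ l) (if_neg hl)
    simp_rw [h1]
    rw [← Finset.sum_filter, Finset.sum_const, nsmul_eq_mul, mul_comm]
    congr 1
    rw [← Fintype.card_subtype, ← Nat.card_eq_fintype_card, ← hinv,
      ColoredGraph.card_invariantFun_faces, Nat.card_eq_fintype_card]
    push_cast
    rfl
  -- The sign gives `(-1)^(p(k + F))` and the contractions give `(-1)^(pk)`, with `k` the number of
  -- pairs and `F` the number of faces; the `k` cancels.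
  rw [faceSum, hsum, hsign, sign_eq_neg_one_pow_orbits, ← hfaces, mul_pow, ← mul_assoc]
  congr 1
  push_cast
  rw [← pow_mul, ← pow_mul, ← pow_mul, ← pow_add, add_mul, Nat.mul_comm p, Nat.mul_comm p,
    add_right_comm, pow_add, ← two_mul, pow_mul, neg_one_sq, one_pow, one_mul]

/-- An alternating coloring exists, and edges can be reversed without changing `faceSum`, so both
pairings may be assumed to be aligned with the coloring. -/
theorem faceSum_eq [DecidableEq X] {C : Type} {p : ℕ} {g : Matrix X X ℂ}
    (hg : ∀ a b, g b a = (-1) ^ p * g a b)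
    (hg2 : g * g = (-1 : ℂ) ^ p • 1) (P E : ι × Fin 2 ≃ V) (G : ColoredGraph C V) {c c' : C}
    (hc : G.mate c = pairMate E) (hc' : G.mate c' = pairMate P) :
    faceSum p g P E = ((-1) ^ p * (Fintype.card X : ℂ)) ^ G.faces c c' := by
  obtain ⟨h, hh⟩ := exists_alternating G c c'
  have h2 : ∀ x : Fin 2, x + x = 0 := by decide
  have hE : ∀ l e, h (E (l, e)) = h (E (l, 0)) + e := fun l e => by
    fin_cases e
    · simp
    · have := (hh (E (l, 0))).1
      rw [hc] at this
      simpa [pairMate] using this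
  have hP : ∀ l e, h (P (l, e)) = h (P (l, 0)) + e := fun l e => by
    fin_cases e
    · simp
    · have := (hh (P (l, 0))).2
      rw [hc'] at this
      simpa [pairMate] using this
  rw [← faceSum_flip_right hg (fun l => h (E (l, 0))),
    ← faceSum_flip_left hg (fun l => h (P (l, 0)))]
  refine faceSum_aligned p g hg2 _ _ h (fun l e => ?_) (fun l e => ?_) G ?_ ?_
  · rw [Equiv.trans_apply, flipPairs_apply, hP, add_left_comm, h2, add_zero]
  · rw [Equiv.trans_apply, flipPairs_apply, hE, add_left_comm, h2, add_zero]
  · rw [pairMate_flipPairs, hc]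
  · rw [pairMate_flipPairs, hc']

end FaceSum

/-! ### Sums over pairings -/

lemma cycleType_of_pairing {k : ℕ} (f : Equiv.Perm (Fin (2 * k))) (h2 : ∀ v, f (f v) = v)
    (hne : ∀ v, f v ≠ v) : f.cycleType = Multiset.replicate k 2 := by
  have h : f ^ 2 = 1 := by
    ext v
    simp [pow_two, h2]
  have hr := Equiv.Perm.cycleType_of_pow_prime_eq_one h
  have hs : f.cycleType.sum = 2 * k := by
    rw [Equiv.Perm.sum_cycleType]
    have : f.support = Finset.univ := by
      ext v
      simp [hne]
    rw [this, Finset.card_univ, Fintype.card_fin]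
  rw [hr, Multiset.sum_replicate, smul_eq_mul] at hs
  rw [hr]
  congr 1
  omega

/-- A permutation carries the reference pairing to `π` iff it conjugates one fixed-point-free
involution to the other. Such permutations form a coset of a centralizer, whose order is read off
the cycle type. -/
lemma card_pairing_fiber {k : ℕ} (π : ColoredGraph Unit (Fin (2 * k))) :
    Nat.card {σ : Equiv.Perm (Fin (2 * k)) //
      pairMate ((refPairing k).trans σ) = π.mate ()} = 2 ^ k * k.factorial := by
  have hflip : ∀ x : Fin 2, x + 1 + 1 = x := by decide
  have h1 : ∀ v, pairMate (refPairing k) (pairMate (refPairing k) v) = v := fun v => by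
    simp [pairMate, hflip]
  have h2 : ∀ v, pairMate (refPairing k) v ≠ v := fun v h => by
    have := congrArg (fun w => ((refPairing k).symm w).2) h
    simp [pairMate] at this
  let τ : Equiv.Perm (Fin (2 * k)) := Function.Involutive.toPerm (pairMate (refPairing k)) h1
  let ρ : Equiv.Perm (Fin (2 * k)) := Function.Involutive.toPerm (π.mate ()) (π.mate_mate ())
  have hτ : τ.cycleType = Multiset.replicate k 2 := cycleType_of_pairing τ h1 h2
  have hρ : ρ.cycleType = Multiset.replicate k 2 :=
    cycleType_of_pairing ρ (π.mate_mate ()) (π.mate_ne ())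
  obtain ⟨σ₀, hσ₀⟩ := isConj_iff.1 (Equiv.Perm.isConj_iff_cycleType_eq.2 (hτ.trans hρ.symm))
  have hiff : ∀ σ : Equiv.Perm (Fin (2 * k)),
      pairMate ((refPairing k).trans σ) = π.mate () ↔ σ * τ * σ⁻¹ = ρ := by
    intro σ
    rw [Equiv.ext_iff, funext_iff]
    rfl
  have hcard : Nat.card (Subgroup.centralizer {τ}) = 2 ^ k * k.factorial := by
    rw [Equiv.Perm.nat_card_centralizer, hτ]
    rcases Nat.eq_zero_or_pos k with rfl | hk
    · simp
    · simp [Multiset.toFinset_replicate, hk.ne', mul_comm]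
  rw [← hcard]
  refine Nat.card_congr ((Equiv.mulLeft σ₀⁻¹).subtypeEquiv fun σ => ?_)
  rw [hiff, ← hσ₀, Equiv.coe_mulLeft, Subgroup.mem_centralizer_singleton_iff,
    mul_inv_eq_iff_eq_mul]
  constructor
  · intro h
    simp only [mul_assoc, h, inv_mul_cancel_left]
  · intro h
    simpa [mul_assoc] using congrArg (σ₀ * ·) h

/-- The graph with a single color whose edges are the pairs of a directed pairing. -/
def pairingGraph {ι V : Type} (E : ι × Fin 2 ≃ V) : ColoredGraph Unit V where
  mate _ := pairMate E
  mate_mate _ v := by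
    have h : ∀ x : Fin 2, x + 1 + 1 = x := by decide
    simp [pairMate, h]
  mate_ne _ v h := by
    have h2 := congrArg (fun w => (E.symm w).2) h
    simp [pairMate] at h2

lemma sum_perm_eq_sum_pairing {k : ℕ} (f : ColoredGraph Unit (Fin (2 * k)) → ℂ) :
    ∑ σ : Equiv.Perm (Fin (2 * k)), f (pairingGraph ((refPairing k).trans σ)) =
      (2 ^ k * k.factorial : ℕ) * ∑ π : ColoredGraph Unit (Fin (2 * k)), f π := by
  classical
  let F : Equiv.Perm (Fin (2 * k)) → ColoredGraph Unit (Fin (2 * k)) := fun σ =>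
    pairingGraph ((refPairing k).trans σ)
  have hF : ∀ σ π, F σ = π ↔ pairMate ((refPairing k).trans σ) = π.mate () := fun σ π =>
    ⟨fun h => h ▸ rfl, fun h => ColoredGraph.ext (funext fun _ => h)⟩
  rw [← Finset.sum_fiberwise _ F, Finset.mul_sum]
  refine Finset.sum_congr rfl fun π _ => ?_
  rw [Finset.sum_congr rfl (g := fun _ => f π), Finset.sum_const, nsmul_eq_mul]
  · congr 2
    rw [← card_pairing_fiber π, Nat.card_eq_fintype_card, Fintype.card_subtype]
    congr 1
    exact Finset.filter_congr fun σ _ => hF σ π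
  · intro σ hσ
    exact congrArg f (Finset.mem_filter.1 hσ).2

/-! ### Wick's theorem -/

section Wick

variable {I A : Type} [Fintype I] [DecidableEq I] [Ring A] [Algebra ℂ A]

/-- The product of the generators with given indices. -/
def word (T : I → A) {n : ℕ} (a : Fin n → I) : A := (List.ofFn fun i => T (a i)).prod

lemma word_succ (T : I → A) {n : ℕ} (a : Fin (n + 1) → I) :
    word T a = T (a 0) * word T (fun i => a i.succ) := by
  simp [word, List.ofFn_succ]

lemma word_zero (T : I → A) (a : Fin 0 → I) : word T a = 1 := by
  simp [word]

/-- A linear functional on an algebra with (anti)commuting generators `T a` that satisfies the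
formula of integration by parts of a centered Gaussian measure of covariance `C`. -/
structure IsGaussian (p : ℕ) (C : I → I → ℂ) (T : I → A) (E : A →ₗ[ℂ] ℂ) : Prop where
  map_one : E 1 = 1
  word_perm : ∀ {n : ℕ} (σ : Equiv.Perm (Fin n)) (a : Fin n → I),
    word T (a ∘ σ) = ((Equiv.Perm.sign σ : ℤ) : ℂ) ^ p • word T a
  exists_deriv : ∃ d : I → A →ₗ[ℂ] A, (∀ b, d b 1 = 0) ∧
    (∀ a b x, d b (T a * x) = (if a = b then x else 0) + (-1 : ℂ) ^ p • (T a * d b x)) ∧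
    ∀ a x, E (T a * x) = ∑ b, C a b * E (d b x)

namespace IsGaussian

variable {p : ℕ} {C : I → I → ℂ} {T : I → A} {E : A →ₗ[ℂ] ℂ}

/-- The Leibniz rule: reaching the `j`-th letter means passing `j` generators, each with a sign
`(-1)^p`. -/
lemma deriv_word {d : I → A →ₗ[ℂ] A} (h1 : ∀ b, d b 1 = 0)
    (hmul : ∀ a b x, d b (T a * x) = (if a = b then x else 0) + (-1 : ℂ) ^ p • (T a * d b x))
    {n : ℕ} (a : Fin (n + 1) → I) (b : I) :
    d b (word T a) = ∑ j : Fin (n + 1),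
      ((-1 : ℂ) ^ p) ^ (j : ℕ) • if a j = b then word T (fun i => a (j.succAbove i)) else 0 := by
  induction n with
  | zero =>
    rw [word_succ, hmul, word_zero, h1, Fin.sum_univ_succ]
    simp [word_zero]
  | succ n ih =>
    rw [word_succ, hmul, ih, Fin.sum_univ_succ (n := n + 1), Finset.mul_sum, Finset.smul_sum]
    congr 1
    · simp
    · refine Finset.sum_congr rfl fun j _ => ?_
      rw [Fin.val_succ, pow_succ', mul_smul, mul_smul_comm]
      congr 2
      split_ifs with h
      · rw [word_succ T fun i => a (j.succ.succAbove i)]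
        simp
      · simp

lemma recursion (hE : IsGaussian p C T E) {n : ℕ} (a : Fin (n + 2) → I) :
    E (word T a) = ∑ j : Fin (n + 1), ((-1 : ℂ) ^ p) ^ (j : ℕ) * (C (a 0) (a j.succ) *
      E (word T fun i => a (j.succAbove i).succ)) := by
  obtain ⟨d, h1, hmul, hparts⟩ := hE.exists_deriv
  rw [word_succ, hparts]
  simp_rw [deriv_word h1 hmul, map_sum, Finset.mul_sum]
  rw [Finset.sum_comm]
  refine Finset.sum_congr rfl fun j _ => ?_
  rw [Finset.sum_eq_single (a j.succ)]
  · simp [mul_left_comm]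
  · intro b _ hb
    simp [hb.symm]
  · simp

lemma refPairing_succ (k : ℕ) (l : Fin k) (e : Fin 2) :
    refPairing (k + 1) (l.succ, e) = ((refPairing k (l, e)).succ.succ : Fin (2 * k + 2)) := by
  apply Fin.ext
  simp [refPairing, finProdFinEquiv]
  ring

/-- Extend a permutation of `0, …, n - 1` by the fixed point `0`. -/
abbrev shiftPerm {n : ℕ} (σ : Equiv.Perm (Fin n)) : Equiv.Perm (Fin (n + 1)) :=
  Equiv.Perm.decomposeFin.symm (0, σ)

lemma sign_pow_shiftPerm {n : ℕ} (σ : Equiv.Perm (Fin n)) :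
    Equiv.Perm.sign (shiftPerm σ) = Equiv.Perm.sign σ := by
  simp [shiftPerm]

lemma shiftPerm_zero {n : ℕ} (σ : Equiv.Perm (Fin n)) : shiftPerm σ 0 = 0 := by
  simp [shiftPerm]

lemma shiftPerm_succ {n : ℕ} (σ : Equiv.Perm (Fin n)) (i : Fin n) :
    shiftPerm σ i.succ = (σ i).succ := by
  simp [shiftPerm]

lemma factorial_mul (hE : IsGaussian p C T E) {n : ℕ} (a : Fin n → I) :
    (n.factorial : ℂ) * E (word T a) = ∑ σ : Equiv.Perm (Fin n),
      ((Equiv.Perm.sign σ : ℤ) : ℂ) ^ p * E (word T (a ∘ σ)) := by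
  simp_rw [hE.word_perm, map_smul, smul_eq_mul, ← mul_assoc, sign_sq_pow, one_mul]
  rw [Finset.sum_const, Finset.card_univ, Fintype.card_perm, Fintype.card_fin, nsmul_eq_mul]

/-- After averaging over all orders of the letters, the `n + 1` possible partners of the first
letter contribute equally. -/
lemma symm_recursion (hE : IsGaussian p C T E) {n : ℕ} (a : Fin (n + 2) → I) :
    ((n + 2).factorial : ℂ) * E (word T a) = (n + 1) * ∑ σ : Equiv.Perm (Fin (n + 2)),
      ((Equiv.Perm.sign σ : ℤ) : ℂ) ^ p * (C (a (σ 0)) (a (σ 1)) *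
        E (word T fun i => a (σ i.succ.succ))) := by
  rw [hE.factorial_mul]
  simp_rw [hE.recursion, Finset.mul_sum]
  rw [Finset.sum_comm]
  have key : ∀ j : Fin (n + 1), ∑ σ : Equiv.Perm (Fin (n + 2)),
      ((Equiv.Perm.sign σ : ℤ) : ℂ) ^ p * (((-1 : ℂ) ^ p) ^ (j : ℕ) *
        (C ((a ∘ σ) 0) ((a ∘ σ) j.succ) *
          E (word T fun i => (a ∘ σ) (j.succAbove i).succ))) =
      ∑ σ : Equiv.Perm (Fin (n + 2)),
      ((Equiv.Perm.sign σ : ℤ) : ℂ) ^ p * (C (a (σ 0)) (a (σ 1)) *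
        E (word T fun i => a (σ i.succ.succ))) := by
    intro j
    -- This cycle fixes position `0` and brings the partner `j.succ` to position `1`; its sign
    -- `(-1)^j` cancels the one from integration by parts.
    rw [← Equiv.sum_comp (Equiv.mulRight (shiftPerm j.cycleRange))]
    refine Finset.sum_congr rfl fun σ _ => ?_
    simp only [Equiv.coe_mulRight, Function.comp_apply, Equiv.Perm.mul_apply, shiftPerm_zero,
      shiftPerm_succ, Fin.cycleRange_succAbove, Fin.cycleRange_self, map_mul, sign_pow_shiftPerm,
      Fin.sign_cycleRange, Units.val_mul, Int.cast_mul, mul_pow]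
    have hj : ((((-1) ^ (j : ℕ) : ℤˣ) : ℤ) : ℂ) ^ p * ((-1 : ℂ) ^ p) ^ (j : ℕ) = 1 := by
      push_cast
      rw [← pow_mul, ← pow_mul, mul_comm p, ← mul_pow]
      simp
    rw [mul_assoc, ← mul_assoc (((((-1) ^ (j : ℕ) : ℤˣ) : ℤ) : ℂ) ^ p), hj, one_mul]
    rfl
  simp_rw [key]
  simp [Finset.mul_sum]

/-- Wick's theorem. -/
theorem wick (hE : IsGaussian p C T E) {k : ℕ} (a : Fin (2 * k) → I) :
    ((2 ^ k * k.factorial : ℕ) : ℂ) * E (word T a) = ∑ σ : Equiv.Perm (Fin (2 * k)),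
      ((Equiv.Perm.sign σ : ℤ) : ℂ) ^ p *
        ∏ l, C (a (σ (refPairing k (l, 0)))) (a (σ (refPairing k (l, 1)))) := by
  induction k with
  | zero => simp [word_zero, hE.map_one]
  | succ k ih =>
    have h := hE.symm_recursion (n := 2 * k) a
    have h2 : ((2 * k).factorial : ℂ) ≠ 0 := by exact_mod_cast Nat.factorial_ne_zero _
    have hn : (2 * (k : ℂ) + 1) ≠ 0 := by exact_mod_cast Nat.succ_ne_zero (2 * k)
    -- The permutation `τ` from the induction hypothesis acts on the last `2k` positions only and is
    -- absorbed into `σ`, so the sum over `τ` is a factor `(2k)!`.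
    have hstep : ((2 ^ k * k.factorial : ℕ) : ℂ) * ∑ σ : Equiv.Perm (Fin (2 * k + 2)),
        ((Equiv.Perm.sign σ : ℤ) : ℂ) ^ p * (C (a (σ 0)) (a (σ 1)) *
          E (word T fun i => a (σ i.succ.succ))) =
        (2 * k).factorial * ∑ σ : Equiv.Perm (Fin (2 * k + 2)),
        ((Equiv.Perm.sign σ : ℤ) : ℂ) ^ p * (C (a (σ 0)) (a (σ 1)) *
          ∏ l, C (a (σ (refPairing k (l, 0)).succ.succ)) (a (σ (refPairing k (l, 1)).succ.succ))) := by
      rw [Finset.mul_sum]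
      simp_rw [mul_left_comm ((2 ^ k * k.factorial : ℕ) : ℂ), ih, Finset.mul_sum]
      rw [Finset.sum_comm]
      have key : ∀ τ : Equiv.Perm (Fin (2 * k)), ∑ σ : Equiv.Perm (Fin (2 * k + 2)),
          ((Equiv.Perm.sign σ : ℤ) : ℂ) ^ p * (C (a (σ 0)) (a (σ 1)) *
            (((Equiv.Perm.sign τ : ℤ) : ℂ) ^ p *
            ∏ l, C (a (σ (τ (refPairing k (l, 0))).succ.succ))
              (a (σ (τ (refPairing k (l, 1))).succ.succ)))) =
          ∑ σ : Equiv.Perm (Fin (2 * k + 2)),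
          ((Equiv.Perm.sign σ : ℤ) : ℂ) ^ p * (C (a (σ 0)) (a (σ 1)) *
          ∏ l, C (a (σ (refPairing k (l, 0)).succ.succ))
            (a (σ (refPairing k (l, 1)).succ.succ))) := by
        intro τ
        symm
        rw [← Equiv.sum_comp (Equiv.mulRight (shiftPerm (shiftPerm τ)))]
        refine Finset.sum_congr rfl fun σ _ => ?_
        have h1 : (shiftPerm (shiftPerm τ)) 1 = 1 := by
          rw [← Fin.succ_zero_eq_one, shiftPerm_succ, shiftPerm_zero]
        simp only [Equiv.coe_mulRight, Equiv.Perm.mul_apply, shiftPerm_zero, h1,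
          shiftPerm_succ, map_mul, sign_pow_shiftPerm, Units.val_mul, Int.cast_mul, mul_pow]
        ring
      rw [Finset.sum_congr rfl fun τ _ => key τ, Finset.sum_const, Finset.card_univ,
        Fintype.card_perm, Fintype.card_fin, nsmul_eq_mul]
      simp_rw [Finset.mul_sum]
    have hprod : ∀ σ : Equiv.Perm (Fin (2 * k + 2)),
        ∏ l, C (a (σ (refPairing (k + 1) (l, 0)))) (a (σ (refPairing (k + 1) (l, 1)))) =
        C (a (σ 0)) (a (σ 1)) * ∏ l, C (a (σ (refPairing k (l, 0)).succ.succ))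
            (a (σ (refPairing k (l, 1)).succ.succ)) := by
      intro σ
      rw [Fin.prod_univ_succ]
      simp_rw [refPairing_succ]
      rfl
    -- The multiplicities match by `(2k)! (2k+1) 2^(k+1) (k+1)! = 2^k k! (2k+2)!`.
    refine mul_left_cancel₀ h2 (mul_left_cancel₀ hn ?_)
    calc _ = ((2 ^ k * k.factorial : ℕ) : ℂ) * (((2 * k + 2).factorial : ℂ) * E (word T a)) := by
          rw [Nat.factorial_succ (2 * k + 1), Nat.factorial_succ (2 * k), Nat.factorial_succ k]
          push_cast
          ring
      _ = _ := by
          rw [h, mul_left_comm, hstep, mul_left_comm]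
          push_cast
          rw [mul_left_comm]
          congr 2
          exact Finset.sum_congr rfl fun σ _ => by rw [← hprod]

end IsGaussian

end Wick

/-! ### The forms -/

lemma omega_symm {n : ℕ} (hn : Even n) (a b : Fin n) : omega n b a = -omega n a b := by
  obtain ⟨m, rfl⟩ := hn
  have ha := a.2
  have hb := b.2
  simp only [omega, Matrix.of_apply]
  split_ifs <;> first | omega | simp

/-- Row `a` has a single nonzero entry, half the dimension further on or back, and the two shifts
carry opposite signs. -/
lemma omega_sq {n : ℕ} (hn : Even n) : omega n * omega n = -1 := by
  obtain ⟨m, rfl⟩ := hn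
  ext a c
  rw [Matrix.mul_apply, Matrix.neg_apply, Matrix.one_apply]
  have ha := a.2
  have hc := c.2
  by_cases h : (a : ℕ) < m
  · rw [Finset.sum_eq_single (⟨a + m, by omega⟩ : Fin (m + m))]
    · simp only [omega, Matrix.of_apply, Fin.ext_iff]
      split_ifs <;> first | omega | simp
    · intro b _ hb
      have hb2 := b.2
      rw [Ne, Fin.ext_iff] at hb
      simp only [omega, Matrix.of_apply]
      split_ifs <;> first | (simp at hb; omega) | simp
    · simp
  · rw [Finset.sum_eq_single (⟨a - m, by omega⟩ : Fin (m + m))]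
    · simp only [omega, Matrix.of_apply, Fin.ext_iff]
      split_ifs <;> first | omega | simp
    · intro b _ hb
      have hb2 := b.2
      rw [Ne, Fin.ext_iff] at hb
      simp only [omega, Matrix.of_apply]
      split_ifs <;> first | (simp at hb; omega) | simp
    · simp

lemma form_symm {p : Fin 2} {n : ℕ} (h : p = 1 → Even n) (a b : Fin n) :
    form p n b a = (-1) ^ (p : ℕ) * form p n a b := by
  fin_cases p
  · simp [form, Matrix.one_apply, eq_comm]
  · simpa [form] using omega_symm (h rfl) a b

lemma form_sq {p : Fin 2} {n : ℕ} (h : p = 1 → Even n) :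
    form p n * form p n = (-1 : ℂ) ^ (p : ℕ) • 1 := by
  fin_cases p
  · simp [form]
  · simpa [form] using omega_sq (h rfl)

section Form

variable {D : ℕ} (par : Fin D → Fin 2) (N : Fin D → ℕ)

lemma formMatrix_symm (hN : ∀ c, par c = 1 → Even (N c)) (a b : Idx N) :
    formMatrix par N b a = (-1) ^ (∑ c, (par c : ℕ)) * formMatrix par N a b := by
  simp only [formMatrix, Matrix.of_apply]
  rw [← Finset.prod_pow_eq_pow_sum, ← Finset.prod_mul_distrib]
  exact Finset.prod_congr rfl fun c _ => form_symm (hN c) _ _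

/-- Together with `formMatrix_symm`, this makes the transpose of the form its inverse, which is why
the transpose appears as the covariance. -/
lemma formMatrix_sq (hN : ∀ c, par c = 1 → Even (N c)) :
    formMatrix par N * formMatrix par N = (-1 : ℂ) ^ (∑ c, (par c : ℕ)) • 1 := by
  ext a b
  rw [Matrix.mul_apply]
  simp only [formMatrix, Matrix.of_apply, ← Finset.prod_mul_distrib]
  rw [← Fintype.piFinset_univ, ← Finset.prod_univ_sum (fun _ => Finset.univ)
    fun c z => form (par c) (N c) (a c) z * form (par c) (N c) z (b c)]
  simp_rw [← Matrix.mul_apply, form_sq (hN _)]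
  simp only [Matrix.smul_apply, Matrix.one_apply, smul_eq_mul, Finset.prod_mul_distrib,
    Finset.prod_pow_eq_pow_sum]
  congr 1
  rw [Fintype.prod_ite_zero]
  simp [funext_iff]

lemma quadratic_eq_dotProduct (T : Idx N → ℂ) :
    quadratic par N T = T ⬝ᵥ (formMatrix par N).mulVec T := by
  simp only [quadratic, dotProduct, Matrix.mulVec, Finset.mul_sum, smul_eq_mul]
  exact Finset.sum_congr rfl fun a _ => Finset.sum_congr rfl fun b _ => by ring

end Form

/-! ### Gaussian integrals over commuting components -/

section Moments

open MeasureTheory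

/-- The weight of the standard Gaussian integral. -/
def gaussWeight (x : ℝ) : ℂ := Complex.exp (-(1 / 2) * (x : ℂ) ^ 2)

lemma integrable_gaussWeight (j : ℕ) : Integrable fun x : ℝ => gaussWeight x * (x : ℂ) ^ j := by
  have h := (integrable_rpow_mul_exp_neg_mul_sq (b := 1 / 2) (by norm_num) (s := (j : ℝ))
    (by linarith [(Nat.cast_nonneg j : (0 : ℝ) ≤ j)])).ofReal (𝕜 := ℂ)
  refine h.congr (Filter.Eventually.of_forall fun x => ?_)
  simp only [Real.rpow_natCast, gaussWeight]
  change ((x ^ j * Real.exp (-(1 / 2) * x ^ 2) : ℝ) : ℂ) = _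
  push_cast
  rw [mul_comm]

/-- The moments of the Gaussian weight. -/
def gaussMoment (j : ℕ) : ℂ := ∫ x : ℝ, gaussWeight x * (x : ℂ) ^ j

/-- The derivative of the weight times `x^j` has integral zero. For `j = 0` the truncated `j - 1` is
harmless because of the factor `j`. -/
lemma gaussMoment_succ (j : ℕ) : gaussMoment (j + 1) = j * gaussMoment (j - 1) := by
  have hderiv : ∀ x : ℝ, HasDerivAt (fun x : ℝ => gaussWeight x * (x : ℂ) ^ j)
      (j * (gaussWeight x * (x : ℂ) ^ (j - 1)) - gaussWeight x * (x : ℂ) ^ (j + 1)) x := by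
    intro x
    have h1 : HasDerivAt (fun z : ℂ => Complex.exp (-(1 / 2) * z ^ 2) * z ^ j)
        (Complex.exp (-(1 / 2) * (x : ℂ) ^ 2) * (-(1 / 2) * (2 * x)) * (x : ℂ) ^ j +
          Complex.exp (-(1 / 2) * (x : ℂ) ^ 2) * (j * (x : ℂ) ^ (j - 1))) (x : ℂ) := by
      refine HasDerivAt.mul (HasDerivAt.cexp ?_) (hasDerivAt_pow j _)
      have h := (hasDerivAt_pow 2 (x : ℂ)).const_mul (-(1 / 2) : ℂ)
      rwa [Nat.cast_ofNat, pow_one] at h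
    convert h1.comp_ofReal using 1
    · rfl
    · rw [show gaussWeight x = Complex.exp (-(1 / 2) * (x : ℂ) ^ 2) from rfl]
      ring
  have hint1 := (integrable_gaussWeight (j - 1)).const_mul (j : ℂ)
  have hint2 := integrable_gaussWeight (j + 1)
  have h := integral_eq_zero_of_hasDerivAt_of_integrable hderiv (hint1.sub hint2)
    (integrable_gaussWeight j)
  rw [integral_sub hint1 hint2, integral_const_mul, sub_eq_zero] at h
  exact h.symm

lemma gaussMoment_zero_ne_zero : gaussMoment 0 ≠ 0 := by
  have h : gaussMoment 0 = ((∫ x : ℝ, Real.exp (-(1 / 2) * x ^ 2) : ℝ) : ℂ) := by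
    rw [← integral_complex_ofReal]
    simp only [gaussMoment, gaussWeight, pow_zero, mul_one]
    push_cast
    rfl
  rw [h, integral_gaussian, Complex.ofReal_ne_zero]
  positivity

variable {I : Type} [Fintype I] [DecidableEq I]

lemma eval_monomial_fintype (x : I → ℂ) (s : I →₀ ℕ) (c : ℂ) :
    MvPolynomial.eval x (MvPolynomial.monomial s c) = c * ∏ i, x i ^ s i := by
  rw [MvPolynomial.eval_monomial, Finsupp.prod_fintype _ _ (by simp)]

lemma integrable_gauss_eval (f : MvPolynomial I ℂ) :
    Integrable fun x : I → ℝ => (∏ i, gaussWeight (x i)) *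
      MvPolynomial.eval (fun i => (x i : ℂ)) f := by
  induction f using MvPolynomial.induction_on' with
  | monomial s c =>
    have h := (Integrable.fintype_prod (f := fun (i : I) (x : ℝ) => gaussWeight x * (x : ℂ) ^ s i)
      fun i => integrable_gaussWeight (s i)).const_mul c
    refine h.congr (Filter.Eventually.of_forall fun x => ?_)
    simp only [eval_monomial_fintype, Finset.prod_mul_distrib]
    ring
  | add f g hf hg =>
    simp only [map_add, mul_add]
    exact hf.add hg

/-- The standard Gaussian integral of polynomials. -/
def gaussIntegral : MvPolynomial I ℂ →ₗ[ℂ] ℂ where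
  toFun f := ∫ x : I → ℝ, (∏ i, gaussWeight (x i)) * MvPolynomial.eval (fun i => (x i : ℂ)) f
  map_add' f g := by
    rw [← integral_add (integrable_gauss_eval f) (integrable_gauss_eval g)]
    simp only [map_add, mul_add]
  map_smul' c f := by
    rw [RingHom.id_apply, smul_eq_mul, ← integral_const_mul]
    congr 1
    ext x
    rw [MvPolynomial.smul_eval]
    ring

lemma gaussIntegral_monomial (s : I →₀ ℕ) (c : ℂ) :
    gaussIntegral (MvPolynomial.monomial s c) = c * ∏ i, gaussMoment (s i) := by
  simp only [gaussMoment]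
  rw [← integral_fintype_prod_volume_eq_prod fun (i : I) (x : ℝ) => gaussWeight x * (x : ℂ) ^ s i,
    ← integral_const_mul]
  change ∫ _, _ = _
  congr 1
  ext x
  simp only [eval_monomial_fintype, Finset.prod_mul_distrib]
  ring

lemma gaussIntegral_one_ne_zero : gaussIntegral (1 : MvPolynomial I ℂ) ≠ 0 := by
  rw [← MvPolynomial.C_1, MvPolynomial.C_apply, gaussIntegral_monomial, one_mul]
  exact Finset.prod_ne_zero_iff.2 fun i _ => gaussMoment_zero_ne_zero

lemma gaussIntegral_X_mul (a : I) (f : MvPolynomial I ℂ) :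
    gaussIntegral (MvPolynomial.X a * f) = gaussIntegral (MvPolynomial.pderiv a f) := by
  induction f using MvPolynomial.induction_on' with
  | monomial s c =>
    rw [MvPolynomial.X, MvPolynomial.monomial_mul, MvPolynomial.pderiv_monomial,
      gaussIntegral_monomial, gaussIntegral_monomial, one_mul,
      ← Finset.mul_prod_erase _ (fun i => gaussMoment ((Finsupp.single a 1 + s : I →₀ ℕ) i))
        (Finset.mem_univ a),
      ← Finset.mul_prod_erase _ (fun i => gaussMoment ((s - Finsupp.single a 1 : I →₀ ℕ) i))
        (Finset.mem_univ a)]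
    have h1 : (Finsupp.single a 1 + s : I →₀ ℕ) a = s a + 1 := by simp [add_comm]
    have h2 : (s - Finsupp.single a 1 : I →₀ ℕ) a = s a - 1 := by simp
    rw [h1, h2, gaussMoment_succ, mul_assoc, mul_assoc]
    congr 3
    refine Finset.prod_congr rfl fun i hi => ?_
    have hia : a ≠ i := (Finset.ne_of_mem_erase hi).symm
    simp [hia]
  | add f g hf hg => rw [mul_add, map_add, map_add, map_add, hf, hg]

/-- Linear substitution of variables. -/
def linearSubst (M : Matrix I I ℂ) : MvPolynomial I ℂ →ₐ[ℂ] MvPolynomial I ℂ :=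
  MvPolynomial.aeval fun a => ∑ c, M a c • MvPolynomial.X c

@[simp] lemma linearSubst_X (M : Matrix I I ℂ) (a : I) :
    linearSubst M (MvPolynomial.X a) = ∑ c, M a c • MvPolynomial.X c := by
  simp [linearSubst]

lemma eval_linearSubst (M : Matrix I I ℂ) (x : I → ℂ) (f : MvPolynomial I ℂ) :
    MvPolynomial.eval x (linearSubst M f) = MvPolynomial.eval (M.mulVec x) f := by
  induction f using MvPolynomial.induction_on with
  | C c => simp [linearSubst]
  | add f g hf hg => simp [hf, hg]
  | mul_X f a hf =>
    rw [map_mul, map_mul, map_mul, hf, linearSubst_X, MvPolynomial.eval_X, map_sum]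
    simp [Matrix.mulVec, dotProduct, MvPolynomial.smul_eval]

lemma pderiv_linearSubst (M : Matrix I I ℂ) (c : I) (f : MvPolynomial I ℂ) :
    MvPolynomial.pderiv c (linearSubst M f) =
      ∑ b, M b c • linearSubst M (MvPolynomial.pderiv b f) := by
  induction f using MvPolynomial.induction_on with
  | C z => simp [linearSubst]
  | add f g hf hg => simp [hf, hg, Finset.sum_add_distrib]
  | mul_X f a hf =>
    rw [map_mul, Derivation.leibniz, hf]
    simp only [Derivation.leibniz, map_add, smul_add, Finset.sum_add_distrib, smul_eq_mul, map_mul,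
      Finset.mul_sum, mul_smul_comm]
    congr 1
    simp only [linearSubst_X, map_sum, MvPolynomial.pderiv_X, Finset.mul_sum]
    rw [Finset.sum_eq_single c, Finset.sum_eq_single a]
    · simp
    · intro b _ hb
      simp [hb]
    · simp
    · intro b _ hb
      simp [hb]
    · simp

/-- Integration by parts in the standard variables and the chain rule give the covariance `M Mᵀ`. -/
lemma gaussIntegral_linearSubst_X_mul (M : Matrix I I ℂ) (a : I) (f : MvPolynomial I ℂ) :
    gaussIntegral (linearSubst M (MvPolynomial.X a * f)) =
      ∑ b, (M * M.transpose) a b * gaussIntegral (linearSubst M (MvPolynomial.pderiv b f)) := by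
  rw [map_mul, linearSubst_X, Finset.sum_mul, map_sum]
  simp only [smul_mul_assoc, map_smul, gaussIntegral_X_mul, pderiv_linearSubst, map_sum,
    smul_eq_mul, Finset.mul_sum, Matrix.mul_apply, Matrix.transpose_apply, Finset.sum_mul]
  rw [Finset.sum_comm]
  exact Finset.sum_congr rfl fun _ _ => Finset.sum_congr rfl fun _ _ => by ring

end Moments

section Boson

variable {D : ℕ} (par : Fin D → Fin 2) (N : Fin D → ℕ)

/-- The matrix of the integration contour. -/
def contourMatrix : Matrix (Idx N) (Idx N) ℂ :=
  (1 / 2 : ℂ) • (1 + formMatrix par N) + (Complex.I / 2) • (1 - formMatrix par N)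

lemma contour_eq (x : Idx N → ℝ) :
    contour par N x = (contourMatrix par N).mulVec fun a => (x a : ℂ) := rfl

lemma contourMatrix_eq : contourMatrix par N =
    ((1 + Complex.I) / 2) • 1 + ((1 - Complex.I) / 2) • formMatrix par N := by
  ext a b
  simp only [contourMatrix, Matrix.add_apply, Matrix.smul_apply, Matrix.sub_apply, smul_eq_mul]
  ring

lemma formMatrix_transpose (hN : ∀ c, par c = 1 → Even (N c)) :
    (formMatrix par N).transpose = (-1 : ℂ) ^ (∑ c, (par c : ℕ)) • formMatrix par N := by
  ext a b
  rw [Matrix.transpose_apply, formMatrix_symm par N hN, Matrix.smul_apply, smul_eq_mul]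

lemma contourMatrix_transpose (hN : ∀ c, par c = 1 → Even (N c))
    (hpar : Even (∑ c, (par c : ℕ))) : (contourMatrix par N).transpose = contourMatrix par N := by
  rw [contourMatrix_eq, Matrix.transpose_add, Matrix.transpose_smul, Matrix.transpose_smul,
    Matrix.transpose_one, formMatrix_transpose par N hN, hpar.neg_one_pow, one_smul]

/-- The contour matrix is `1` and `i` on the eigenspaces of the form for `1` and `-1`. It is a
symmetric square root of the form, so it produces exactly the required covariance. -/
lemma contourMatrix_sq (hN : ∀ c, par c = 1 → Even (N c))
    (hpar : Even (∑ c, (par c : ℕ))) : contourMatrix par N * contourMatrix par N =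
      formMatrix par N := by
  have h := formMatrix_sq par N hN
  rw [hpar.neg_one_pow, one_smul] at h
  have hI : Complex.I * Complex.I = -1 := Complex.I_mul_I
  rw [contourMatrix_eq]
  simp only [add_mul, mul_add, smul_mul_smul_comm, mul_one, one_mul, h]
  ext a b
  simp only [Matrix.add_apply, Matrix.smul_apply, smul_eq_mul]
  linear_combination ((1 : Matrix (Idx N) (Idx N) ℂ) a b / 2 - formMatrix par N a b / 2) * hI

lemma quadratic_contour (hN : ∀ c, par c = 1 → Even (N c)) (hpar : Even (∑ c, (par c : ℕ)))
    (x : Idx N → ℝ) : quadratic par N (contour par N x) = ∑ a, (x a : ℂ) ^ 2 := by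
  have h : contourMatrix par N * (formMatrix par N * contourMatrix par N) = 1 := by
    rw [← contourMatrix_sq par N hN hpar, ← mul_assoc, ← mul_assoc, mul_assoc,
      contourMatrix_sq par N hN hpar, formMatrix_sq par N hN, hpar.neg_one_pow, one_smul]
  rw [quadratic_eq_dotProduct, contour_eq, Matrix.mulVec_mulVec,
    ← contourMatrix_transpose par N hN hpar, Matrix.mulVec_transpose,
    ← Matrix.dotProduct_mulVec, Matrix.mulVec_mulVec, contourMatrix_transpose par N hN hpar, h,
    Matrix.one_mulVec]
  simp [dotProduct, pow_two]

lemma bosonGaussianIntegral_eq (hN : ∀ c, par c = 1 → Even (N c))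
    (hpar : Even (∑ c, (par c : ℕ))) (f : MvPolynomial (Idx N) ℂ) :
    bosonGaussianIntegral par N f = gaussIntegral (linearSubst (contourMatrix par N) f) := by
  change _ = ∫ _, _
  rw [bosonGaussianIntegral]
  congr 1
  ext x
  rw [quadratic_contour par N hN hpar, eval_linearSubst, ← contour_eq, Finset.mul_sum,
    Complex.exp_sum]
  rfl

/-- The normalized Gaussian expectation value for commuting components, as a linear functional. -/
def bosonFunctional : MvPolynomial (Idx N) ℂ →ₗ[ℂ] ℂ :=
  (gaussIntegral (1 : MvPolynomial (Idx N) ℂ))⁻¹ •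
    gaussIntegral ∘ₗ (linearSubst (contourMatrix par N)).toLinearMap

lemma bosonGaussian_eq (hN : ∀ c, par c = 1 → Even (N c)) (hpar : Even (∑ c, (par c : ℕ)))
    (f : MvPolynomial (Idx N) ℂ) : bosonGaussian par N f = bosonFunctional par N f := by
  rw [bosonGaussian, bosonGaussianIntegral_eq par N hN hpar, bosonGaussianIntegral_eq par N hN hpar,
    map_one, div_eq_inv_mul]
  rfl

theorem isGaussian_boson (hN : ∀ c, par c = 1 → Even (N c)) (hpar : Even (∑ c, (par c : ℕ))) :
    IsGaussian (∑ c, (par c : ℕ)) (fun a b => formMatrix par N b a) MvPolynomial.X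
      (bosonFunctional par N) where
  map_one := by
    simp [bosonFunctional, gaussIntegral_one_ne_zero]
  word_perm σ a := by
    have hs : ((Equiv.Perm.sign σ : ℤ) : ℂ) ^ (∑ c, (par c : ℕ)) = 1 := by
      obtain ⟨m, hm⟩ := hpar
      rw [hm, pow_add, sign_sq_pow]
    rw [hs, one_smul, word, word, List.prod_ofFn, List.prod_ofFn]
    exact Equiv.prod_comp σ fun i => MvPolynomial.X (a i)
  exists_deriv := by
    refine ⟨fun b => (MvPolynomial.pderiv b).toLinearMap, fun b => ?_, fun a b x => ?_,
      fun a x => ?_⟩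
    · simp
    · simp only [Derivation.coeFn_coe, Derivation.leibniz,
        MvPolynomial.pderiv_X, smul_eq_mul, hpar.neg_one_pow, one_smul, Pi.single_apply]
      rw [add_comm]
      by_cases h : a = b <;> simp [h]
    · have hsymm : ∀ b, formMatrix par N b a = (contourMatrix par N *
          (contourMatrix par N).transpose) a b := fun b => by
        rw [contourMatrix_transpose par N hN hpar, contourMatrix_sq par N hN hpar,
          formMatrix_symm par N hN, hpar.neg_one_pow, one_mul]
      simp only [bosonFunctional, LinearMap.smul_apply, LinearMap.comp_apply,
        AlgHom.toLinearMap_apply, gaussIntegral_linearSubst_X_mul, hsymm, smul_eq_mul,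
        Finset.mul_sum]
      exact Finset.sum_congr rfl fun b _ => mul_left_comm _ _ _

end Boson

/-! ### Gaussian integrals over anticommuting components -/

section Fermion

variable {D : ℕ} (par : Fin D → Fin 2) (N : Fin D → ℕ)

lemma grassmannVar_sq (a : Idx N) : grassmannVar N a * grassmannVar N a = 0 :=
  ExteriorAlgebra.ι_sq_zero _

lemma grassmannVar_anticomm (a b : Idx N) :
    grassmannVar N a * grassmannVar N b = -(grassmannVar N b * grassmannVar N a) :=
  eq_neg_of_add_eq_zero_left (ExteriorAlgebra.ι_add_mul_swap _ _)

lemma grassmannDeriv_one (b : Idx N) : grassmannDeriv N b 1 = 0 :=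
  CliffordAlgebra.contractLeft_one _ _

lemma grassmannDeriv_var_mul (a b : Idx N) (x : Grassmann N) :
    grassmannDeriv N b (grassmannVar N a * x) =
      (if a = b then x else 0) - grassmannVar N a * grassmannDeriv N b x := by
  have h := CliffordAlgebra.contractLeft_ι_mul (Q := (0 : QuadraticForm ℂ (Idx N → ℂ)))
    (LinearMap.proj b) (Pi.single a (1 : ℂ)) x
  refine h.trans ?_
  congr 1
  by_cases hab : a = b
  · subst hab
    simp
  · simp [hab, Ne.symm hab]

lemma pair_commute_var (a b c : Idx N) :
    Commute (grassmannVar N a * grassmannVar N b) (grassmannVar N c) := by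
  rw [Commute, SemiconjBy, mul_assoc, grassmannVar_anticomm N b c, mul_neg, ← mul_assoc,
    grassmannVar_anticomm N a c, neg_mul, neg_neg, mul_assoc]

/-- The exponent of the Gaussian weight. -/
def gaussExponent : Grassmann N := -(1 / 2 : ℂ) • quadratic par N (grassmannVar N)

lemma gaussExponent_commute_var (c : Idx N) :
    Commute (gaussExponent par N) (grassmannVar N c) := by
  refine Commute.smul_left ?_ _
  refine Commute.sum_left _ _ _ fun a _ => Commute.sum_left _ _ _ fun b _ => ?_
  exact (pair_commute_var N a b c).smul_left _

lemma isNilpotent_gaussExponent : IsNilpotent (gaussExponent par N) := by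
  have hcomm : ∀ (a b c d : Idx N) (z w : ℂ), Commute (z • (grassmannVar N a * grassmannVar N b))
      (w • (grassmannVar N c * grassmannVar N d)) := fun a b c d z w =>
    (((pair_commute_var N a b c).mul_right (pair_commute_var N a b d)).smul_left z).smul_right w
  refine IsNilpotent.smul ?_ _
  refine Commute.isNilpotent_sum (fun a _ => Commute.isNilpotent_sum (fun b _ => ?_) ?_) ?_
  · refine IsNilpotent.smul ⟨2, ?_⟩ _
    rw [pow_two, ← mul_assoc, mul_assoc _ _ (grassmannVar N a), grassmannVar_anticomm N b a,
      mul_neg, ← mul_assoc, grassmannVar_sq]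
    simp
  · exact fun b c _ _ => hcomm _ _ _ _ _ _
  · exact fun a c _ _ => Commute.sum_left _ _ _ fun b _ => Commute.sum_right _ _ _ fun d _ =>
      hcomm _ _ _ _ _ _

/-- The derivative of the exponent of the Gaussian weight. -/
def gaussForce (b : Idx N) : Grassmann N := -∑ a, formMatrix par N b a • grassmannVar N a

/-- The exponent is quadratic, so the derivative passes it without a sign; by antisymmetry of the
form, both positions contribute the same and cancel the factor `1/2`. -/
lemma grassmannDeriv_gaussExponent_mul (hN : ∀ c, par c = 1 → Even (N c))
    (hpar : Odd (∑ c, (par c : ℕ))) (b : Idx N) (x : Grassmann N) :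
    grassmannDeriv N b (gaussExponent par N * x) =
      gaussForce par N b * x + gaussExponent par N * grassmannDeriv N b x := by
  have h1 : ∀ a a', grassmannDeriv N b (grassmannVar N a * grassmannVar N a' * x) =
      (if a = b then grassmannVar N a' * x else 0) - (if a' = b then grassmannVar N a * x else 0) +
        grassmannVar N a * grassmannVar N a' * grassmannDeriv N b x := by
    intro a a'
    rw [mul_assoc, grassmannDeriv_var_mul, grassmannDeriv_var_mul, mul_sub, mul_assoc]
    split_ifs <;> (try rw [mul_zero]) <;> abel
  have hanti : ∀ a, formMatrix par N a b = -formMatrix par N b a := fun a => by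
    rw [formMatrix_symm par N hN, hpar.neg_one_pow, neg_one_mul]
  simp only [gaussExponent, quadratic, smul_mul_assoc, Finset.sum_mul, map_smul, map_sum, h1,
    smul_add, smul_sub, Finset.sum_add_distrib, Finset.sum_sub_distrib]
  congr 1
  simp only [smul_ite, smul_zero, Finset.sum_ite_eq', Finset.mem_univ, if_true, hanti,
    Finset.sum_neg_distrib, neg_smul, gaussForce, neg_mul, Finset.sum_mul, smul_mul_assoc]
  rw [Finset.sum_comm]
  simp only [Finset.sum_ite_eq', Finset.mem_univ, if_true]
  module

lemma gaussExponent_commute_force (b : Idx N) :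
    Commute (gaussExponent par N) (gaussForce par N b) :=
  (Commute.sum_right _ _ _ fun a _ => (gaussExponent_commute_var par N a).smul_right _).neg_right

lemma grassmannDeriv_gaussExponent_pow_mul (hN : ∀ c, par c = 1 → Even (N c))
    (hpar : Odd (∑ c, (par c : ℕ))) (b : Idx N) (n : ℕ) (x : Grassmann N) :
    grassmannDeriv N b (gaussExponent par N ^ n * x) =
      (n : ℂ) • (gaussExponent par N ^ (n - 1) * (gaussForce par N b * x)) +
        gaussExponent par N ^ n * grassmannDeriv N b x := by
  induction n with
  | zero => simp
  | succ n ih =>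
    rw [pow_succ', mul_assoc, grassmannDeriv_gaussExponent_mul par N hN hpar, ih, mul_add,
      mul_smul_comm, ← mul_assoc (gaussForce par N b),
      ← ((gaussExponent_commute_force par N b).pow_left n).eq, Nat.add_sub_cancel, ← add_assoc,
      mul_assoc, mul_assoc]
    congr 1
    rcases n with _ | n
    · simp
    · rw [Nat.add_sub_cancel, ← mul_assoc (gaussExponent par N), ← pow_succ']
      push_cast
      module

lemma exp_gaussExponent {K : ℕ} (hK : gaussExponent par N ^ K = 0) :
    IsNilpotent.exp (gaussExponent par N) =
      ∑ n ∈ Finset.range K, ((n.factorial : ℂ)⁻¹) • gaussExponent par N ^ n := by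
  rw [IsNilpotent.exp_eq_sum hK]
  refine Finset.sum_congr rfl fun n _ => ?_
  rw [← algebraMap_smul ℂ ((n.factorial : ℚ)⁻¹)]
  simp

lemma grassmannDeriv_exp_mul (hN : ∀ c, par c = 1 → Even (N c))
    (hpar : Odd (∑ c, (par c : ℕ))) (b : Idx N) (x : Grassmann N) :
    grassmannDeriv N b (IsNilpotent.exp (gaussExponent par N) * x) =
      IsNilpotent.exp (gaussExponent par N) * (gaussForce par N b * x) +
        IsNilpotent.exp (gaussExponent par N) * grassmannDeriv N b x := by
  obtain ⟨K, hK⟩ := isNilpotent_gaussExponent par N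
  -- One superfluous term is kept: differentiation kills the term `n = 0` and shifts the sum, while
  -- on the other side the last term contains the vanishing `K`-th power.
  have hK1 : gaussExponent par N ^ (K + 1) = 0 := by rw [pow_succ, hK, zero_mul]
  rw [exp_gaussExponent par N hK1]
  simp only [Finset.sum_mul, map_sum, smul_mul_assoc, map_smul,
    grassmannDeriv_gaussExponent_pow_mul par N hN hpar, smul_add, Finset.sum_add_distrib]
  congr 1
  rw [Finset.sum_range_succ', Finset.sum_range_succ _ K, hK]
  simp only [Nat.cast_zero, zero_smul, smul_zero, add_zero, zero_mul, Nat.add_sub_cancel]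
  refine Finset.sum_congr rfl fun n _ => ?_
  rw [smul_smul]
  congr 1
  rw [Nat.factorial_succ]
  have h1 : (n.factorial : ℂ) ≠ 0 := by exact_mod_cast Nat.factorial_ne_zero _
  have h2 : ((n : ℂ) + 1) ≠ 0 := by exact_mod_cast Nat.succ_ne_zero n
  push_cast
  field_simp

/-- The iterated derivative. -/
def iterDeriv (l : List (Idx N)) : Grassmann N →ₗ[ℂ] Grassmann N :=
  l.foldr (fun a h => grassmannDeriv N a ∘ₗ h) LinearMap.id

lemma iterDeriv_apply (l : List (Idx N)) (x : Grassmann N) :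
    iterDeriv N l x = l.foldr (fun a h => grassmannDeriv N a h) x := by
  induction l with
  | nil => rfl
  | cons a l ih => rw [List.foldr_cons, ← ih]; rfl

lemma iterDeriv_cons (a : Idx N) (l : List (Idx N)) (x : Grassmann N) :
    iterDeriv N (a :: l) x = grassmannDeriv N a (iterDeriv N l x) := rfl

lemma grassmannDeriv_anticomm (a b : Idx N) (x : Grassmann N) :
    grassmannDeriv N a (grassmannDeriv N b x) = -grassmannDeriv N b (grassmannDeriv N a x) :=
  CliffordAlgebra.contractLeft_comm _ _ _

lemma iterDeriv_deriv (l : List (Idx N)) (a : Idx N) (x : Grassmann N) :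
    iterDeriv N l (grassmannDeriv N a x) =
      (-1 : ℂ) ^ l.length • grassmannDeriv N a (iterDeriv N l x) := by
  induction l with
  | nil => simp [iterDeriv]
  | cons b l ih =>
    rw [iterDeriv_cons, ih, map_smul, grassmannDeriv_anticomm, ← iterDeriv_cons, List.length_cons,
      pow_succ, mul_smul, neg_one_smul]

/-- The derivative can be moved, up to sign, next to its other copy, and its square is zero. -/
lemma iterDeriv_deriv_of_mem {l : List (Idx N)} {a : Idx N} (h : a ∈ l) (x : Grassmann N) :
    iterDeriv N l (grassmannDeriv N a x) = 0 := by
  induction l with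
  | nil => simp at h
  | cons b l ih =>
    rw [iterDeriv_cons]
    rcases List.mem_cons.1 h with rfl | h
    · rw [iterDeriv_deriv, map_smul]
      rw [show grassmannDeriv N a (grassmannDeriv N a (iterDeriv N l x)) = 0 from
        CliffordAlgebra.contractLeft_contractLeft _ _, smul_zero]
    · rw [ih h, map_zero]

/-- The last derivative of the list acts first, so in the reversed word each derivative meets its
own generator in front. The factor `z` carries the generators still to be removed. -/
lemma iterDeriv_word {l : List (Idx N)} (hl : l.Nodup) (z : Grassmann N)
    (hz : ∀ b ∈ l, grassmannDeriv N b z = 0) :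
    iterDeriv N l ((l.reverse.map (grassmannVar N)).prod * z) = z := by
  induction l generalizing z with
  | nil => simp [iterDeriv]
  | cons a l ih =>
    rw [List.nodup_cons] at hl
    rw [iterDeriv_cons, List.reverse_cons, List.map_append, List.prod_append, mul_assoc,
      List.map_singleton, List.prod_singleton, ih hl.2, grassmannDeriv_var_mul,
      hz a List.mem_cons_self]
    · simp
    · intro b hb
      have hab : a ≠ b := fun h => hl.1 (h ▸ hb)
      rw [grassmannDeriv_var_mul, hz b (List.mem_cons_of_mem _ hb)]
      simp [hab]

lemma var_mul_word {l : List (Idx N)} {a : Idx N} (h : a ∈ l) :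
    grassmannVar N a * (l.map (grassmannVar N)).prod = 0 := by
  induction l with
  | nil => simp at h
  | cons b l ih =>
    rw [List.map_cons, List.prod_cons, ← mul_assoc]
    rcases List.mem_cons.1 h with rfl | h
    · rw [grassmannVar_sq, zero_mul]
    · rw [grassmannVar_anticomm, neg_mul, mul_assoc, ih h, mul_zero, neg_zero]

/-- The Berezin integral as a linear functional. -/
def berezinFunctional : Grassmann N →ₗ[ℂ] ℂ :=
  ExteriorAlgebra.algebraMapInv.toLinearMap ∘ₗ iterDeriv N (Finset.univ : Finset (Idx N)).toList

lemma berezin_eq (f : Grassmann N) : berezin N f = berezinFunctional N f := by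
  rw [berezin, ← iterDeriv_apply]
  rfl

lemma berezinFunctional_deriv (a : Idx N) (x : Grassmann N) :
    berezinFunctional N (grassmannDeriv N a x) = 0 := by
  rw [berezinFunctional, LinearMap.comp_apply, iterDeriv_deriv_of_mem N (by simp), map_zero]

/-- The Gaussian integral over anticommuting components as a linear functional. -/
def fermionIntegral : Grassmann N →ₗ[ℂ] ℂ :=
  berezinFunctional N ∘ₗ LinearMap.mulLeft ℂ (IsNilpotent.exp (gaussExponent par N))

lemma fermionGaussianIntegral_eq (f : Grassmann N) :
    fermionGaussianIntegral par N f = fermionIntegral par N f := berezin_eq N _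

/-- Berezin integrals of derivatives vanish. Differentiating the weight produces the form applied to
the generators, and the form is inverted by its transpose. -/
lemma fermionIntegral_var_mul (hN : ∀ c, par c = 1 → Even (N c))
    (hpar : Odd (∑ c, (par c : ℕ))) (a : Idx N) (x : Grassmann N) :
    fermionIntegral par N (grassmannVar N a * x) =
      ∑ b, formMatrix par N b a * fermionIntegral par N (grassmannDeriv N b x) := by
  have h1 : ∀ b, fermionIntegral par N (grassmannDeriv N b x) =
      ∑ c, formMatrix par N b c * fermionIntegral par N (grassmannVar N c * x) := by
    intro b
    have h := berezinFunctional_deriv N b (IsNilpotent.exp (gaussExponent par N) * x)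
    rw [grassmannDeriv_exp_mul par N hN hpar, map_add] at h
    have h' : fermionIntegral par N (gaussForce par N b * x) +
      fermionIntegral par N (grassmannDeriv N b x) = 0 := h
    rw [eq_neg_of_add_eq_zero_right h', gaussForce, neg_mul, map_neg, neg_neg, Finset.sum_mul,
      map_sum]
    simp
  have hsq := formMatrix_sq par N hN
  rw [hpar.neg_one_pow] at hsq
  simp_rw [h1, Finset.mul_sum, ← mul_assoc]
  rw [Finset.sum_comm]
  simp_rw [← Finset.sum_mul]
  have h2 : ∀ c, ∑ b, formMatrix par N b a * formMatrix par N b c = if a = c then 1 else 0 := by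
    intro c
    have h := congrFun (congrFun hsq a) c
    rw [Matrix.mul_apply] at h
    simp_rw [formMatrix_symm par N hN a, hpar.neg_one_pow, neg_one_mul, neg_mul,
      Finset.sum_neg_distrib, h]
    by_cases hac : a = c <;> simp [hac]
  simp [h2]

/-- If the integral of `1` vanished, integration by parts would make it vanish on all words. But on
the product of all generators the exponential acts as `1`, and the Berezin integral is `1`. -/
lemma fermionIntegral_one_ne_zero (hN : ∀ c, par c = 1 → Even (N c))
    (hpar : Odd (∑ c, (par c : ℕ))) : fermionIntegral par N 1 ≠ 0 := by
  intro h0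
  have hword : ∀ (n : ℕ) (a : Fin n → Idx N),
      fermionIntegral par N (word (grassmannVar N) a) = 0 := by
    intro n
    induction n using Nat.strong_induction_on with
    | _ n ih =>
      intro a
      rcases n with _ | _ | n
      · rw [word_zero, h0]
      · rw [word_succ, word_zero, fermionIntegral_var_mul par N hN hpar]
        simp [grassmannDeriv_one]
      · rw [word_succ, fermionIntegral_var_mul par N hN hpar]
        refine Finset.sum_eq_zero fun b _ => ?_
        rw [IsGaussian.deriv_word (p := 1) (T := grassmannVar N) (d := grassmannDeriv N)
          (grassmannDeriv_one N) (fun a b x => by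
            rw [grassmannDeriv_var_mul, pow_one, neg_one_smul, sub_eq_add_neg]), map_sum,
          Finset.sum_eq_zero, mul_zero]
        intro j _
        rw [map_smul]
        split_ifs
        · rw [ih n (by omega), smul_zero]
        · simp
  let l := (Finset.univ : Finset (Idx N)).toList.reverse
  let h := (l.map (grassmannVar N)).prod
  have hX : gaussExponent par N * h = 0 := by
    simp only [gaussExponent, quadratic, smul_mul_assoc, Finset.sum_mul, mul_assoc]
    have : ∀ b, grassmannVar N b * h = 0 := fun b => var_mul_word N (by simp [l])
    simp [this]
  have hexp : IsNilpotent.exp (gaussExponent par N) * h = h := by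
    obtain ⟨K, hK⟩ := isNilpotent_gaussExponent par N
    have hK1 : gaussExponent par N ^ (K + 1) = 0 := by rw [pow_succ, hK, zero_mul]
    rw [exp_gaussExponent par N hK1, Finset.sum_mul, Finset.sum_range_succ', Finset.sum_eq_zero]
    · simp
    · intro n _
      rw [smul_mul_assoc, pow_succ, mul_assoc, hX, mul_zero, smul_zero]
  have h1 : fermionIntegral par N h = 1 := by
    rw [fermionIntegral, LinearMap.comp_apply, LinearMap.mulLeft_apply, hexp, berezinFunctional,
      LinearMap.comp_apply]
    have := iterDeriv_word N (Finset.nodup_toList (Finset.univ : Finset (Idx N))) 1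
      fun b _ => grassmannDeriv_one N b
    rw [mul_one] at this
    rw [this]
    simp
  have h2 : h = word (grassmannVar N) fun i : Fin l.length => l.get i := by
    simp only [h, word]
    congr 1
    rw [show (fun i => grassmannVar N (l.get i)) = grassmannVar N ∘ l.get from rfl,
      ← List.map_ofFn, List.ofFn_get]
  rw [h2, hword] at h1
  exact zero_ne_one h1

/-- The normalized Gaussian expectation value for anticommuting components, as a linear
functional. -/
def fermionFunctional : Grassmann N →ₗ[ℂ] ℂ :=
  (fermionIntegral par N 1)⁻¹ • fermionIntegral par N

lemma fermionGaussian_eq (f : Grassmann N) :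
    fermionGaussian par N f = fermionFunctional par N f := by
  rw [fermionGaussian, fermionGaussianIntegral_eq, fermionGaussianIntegral_eq, div_eq_inv_mul]
  rfl

theorem isGaussian_fermion (hN : ∀ c, par c = 1 → Even (N c)) (hpar : Odd (∑ c, (par c : ℕ))) :
    IsGaussian (∑ c, (par c : ℕ)) (fun a b => formMatrix par N b a) (grassmannVar N)
      (fermionFunctional par N) where
  map_one := by
    simp [fermionFunctional, fermionIntegral_one_ne_zero par N hN hpar]
  word_perm σ a := by
    have hs : ((Equiv.Perm.sign σ : ℤ) : ℂ) ^ (∑ c, (par c : ℕ)) = (Equiv.Perm.sign σ : ℤ) := by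
      rcases Int.units_eq_one_or (Equiv.Perm.sign σ) with h | h <;> simp [h, hpar.neg_one_pow]
    have h := (ExteriorAlgebra.ιMulti ℂ _).map_perm (fun i => (Pi.single (a i) (1 : ℂ) : Idx N → ℂ)) σ
    rw [ExteriorAlgebra.ιMulti_apply, ExteriorAlgebra.ιMulti_apply] at h
    rw [hs, Int.cast_smul_eq_zsmul]
    exact h
  exists_deriv := by
    refine ⟨grassmannDeriv N, grassmannDeriv_one N, fun a b x => ?_, fun a x => ?_⟩
    · rw [grassmannDeriv_var_mul, hpar.neg_one_pow, neg_one_smul, sub_eq_add_neg]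
    · simp only [fermionFunctional, LinearMap.smul_apply, fermionIntegral_var_mul par N hN hpar,
        smul_eq_mul, Finset.mul_sum]
      exact Finset.sum_congr rfl fun b _ => mul_left_comm _ _ _

end Fermion

/-! ### Gaussian expectation values of trace invariants -/

section Expectation

variable {D : ℕ} {V : Type}

/-- Add the edges of color `0` to a graph. -/
def addColor (H : ColoredGraph (Fin D) V) (π : ColoredGraph Unit V) :
    ColoredGraph (Fin (D + 1)) V where
  mate := Fin.cons (π.mate ()) H.mate
  mate_mate c v := by
    refine Fin.cases ?_ (fun c => ?_) c
    · exact π.mate_mate () v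
    · exact H.mate_mate c v
  mate_ne c v := by
    refine Fin.cases ?_ (fun c => ?_) c
    · exact π.mate_ne () v
    · exact H.mate_ne c v

lemma extSum_eq_sum_addColor [Finite V] (par : Fin D → Fin 2) (N : Fin D → ℤ)
    (H : ColoredGraph (Fin D) V) :
    extSum par N H = ∑ π : ColoredGraph Unit V, faceFactor par N (addColor H π) := by
  classical
  symm
  refine Finset.sum_bij (fun π _ => addColor H π) ?_ ?_ ?_ ?_
  · intro π _
    simp only [Finset.mem_filter, Finset.mem_univ, true_and]
    rfl
  · intro π _ π' _ h
    ext1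
    funext c
    exact congrFun (congrArg ColoredGraph.mate h) 0
  · intro G hG
    simp only [Finset.mem_filter, Finset.mem_univ, true_and] at hG
    refine ⟨⟨fun _ => G.mate 0, fun _ => G.mate_mate 0, fun _ => G.mate_ne 0⟩,
      Finset.mem_univ _, ?_⟩
    ext1
    funext c
    refine Fin.cases rfl (fun c => ?_) c
    exact (congrFun (congrArg ColoredGraph.mate hG) c).symm
  · intro _ _
    rfl

variable (par : Fin D → Fin 2) (N : Fin D → ℕ)

/-- The coefficient of a word in a trace invariant. -/
def traceCoeff {k : ℕ} (E : DirectedGraph D k) (a : Fin (2 * k) → Idx N) : ℂ :=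
  ∏ c, (((pairingSign (refPairing k) (E c) : ℤ) : ℂ) ^ (par c : ℕ) *
    ∏ l : Fin k, form (par c) (N c) (a (E c (l, 0)) c) (a (E c (l, 1)) c))

variable {A : Type} [Ring A] [Algebra ℂ A] {T : Idx N → A}

lemma traceInvariant_eq (T : Idx N → A) {k : ℕ} (E : DirectedGraph D k) :
    traceInvariant par N T E = ∑ a, traceCoeff par N E a • word T a := rfl

/-- The sign from Wick's theorem gives each color `c` a factor `sign σ ^ |c|`. It combines with the
sign relative to the reference pairing into the sign of `E c` relative to the Wick pairing itself.
-/
lemma sum_traceCoeff_mul {k : ℕ} (E : DirectedGraph D k) (σ : Equiv.Perm (Fin (2 * k))) :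
    ∑ a, traceCoeff par N E a * (((Equiv.Perm.sign σ : ℤ) : ℂ) ^ (∑ c, (par c : ℕ)) *
      ∏ l, formMatrix par N (a (σ (refPairing k (l, 1)))) (a (σ (refPairing k (l, 0))))) =
    ∏ c, faceSum (par c) (form (par c) (N c)) ((refPairing k).trans σ) (E c) := by
  have hsign : ∀ c, Equiv.Perm.sign (((refPairing k).trans σ).symm.trans (E c)) =
      pairingSign (refPairing k) (E c) * Equiv.Perm.sign σ := by
    intro c
    have : ((refPairing k).trans σ).symm.trans (E c) =
        σ.symm.trans ((refPairing k).symm.trans (E c)) := rfl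
    rw [this, Equiv.Perm.sign_trans, Equiv.Perm.sign_symm, pairingSign]
  simp only [faceSum, hsign, Finset.mul_sum]
  rw [Finset.prod_univ_sum (fun _ => Finset.univ), Fintype.piFinset_univ,
    ← Equiv.sum_comp (Equiv.piComm fun (_ : Fin (2 * k)) (c : Fin D) => Fin (N c))]
  refine Finset.sum_congr rfl fun a _ => ?_
  simp only [traceCoeff, formMatrix, Matrix.of_apply, Finset.prod_comm (s := Finset.univ (α := Fin k)),
    ← Finset.prod_pow_eq_pow_sum, ← Finset.prod_mul_distrib, Equiv.piComm_apply,
    Equiv.trans_apply, Function.swap, Units.val_mul, Int.cast_mul, mul_pow]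
  refine Finset.prod_congr rfl fun c _ => ?_
  rw [Finset.prod_mul_distrib]
  ring

/-- The Wick pairings are the possible choices of the edges of color `0`, and `faceSum_eq` evaluates
each color. The multiplicity `2^k k!` cancels against that in `sum_perm_eq_sum_pairing`. -/
theorem expectation_traceInvariant (hN : ∀ c, par c = 1 → Even (N c)) {E : A →ₗ[ℂ] ℂ}
    (hE : IsGaussian (∑ c, (par c : ℕ)) (fun a b => formMatrix par N b a) T E) {k : ℕ}
    (Γ : DirectedGraph D k) :
    E (traceInvariant par N T Γ) = extSum par (fun c => (N c : ℤ)) Γ.undirected := by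
  have hk : ((2 ^ k * k.factorial : ℕ) : ℂ) ≠ 0 := by
    have := Nat.factorial_ne_zero k
    exact_mod_cast (by positivity : 2 ^ k * k.factorial ≠ 0)
  refine mul_left_cancel₀ hk ?_
  rw [traceInvariant_eq, map_sum, Finset.mul_sum]
  simp_rw [map_smul, smul_eq_mul, mul_left_comm ((2 ^ k * k.factorial : ℕ) : ℂ), hE.wick,
    Finset.mul_sum]
  rw [Finset.sum_comm]
  simp_rw [sum_traceCoeff_mul]
  rw [extSum_eq_sum_addColor, Int.cast_sum, ← sum_perm_eq_sum_pairing]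
  refine Finset.sum_congr rfl fun σ _ => ?_
  rw [faceFactor]
  push_cast
  refine Finset.prod_congr rfl fun c _ => ?_
  rw [faceSum_eq (form_symm (hN c)) (form_sq (hN c)) _ _
    (addColor Γ.undirected (pairingGraph ((refPairing k).trans σ))) (c := c.succ) (c' := 0) rfl rfl,
    Fintype.card_fin]

/-! ### Products of trace invariants -/

/-- The vertices of a disjoint union. -/
def unionVertexEquiv (k m : ℕ) : Fin (2 * k) ⊕ Fin (2 * m) ≃ Fin (2 * (k + m)) :=
  finSumFinEquiv.trans (finCongr (by ring))

/-- The union of directed pairings of two disjoint sets of vertices. -/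
def unionPairing {k m : ℕ} (P : DirectedPairing k) (Q : DirectedPairing m) :
    DirectedPairing (k + m) :=
  ((Equiv.prodCongrLeft fun _ => finSumFinEquiv.symm).trans
    (Equiv.sumProdDistrib (Fin k) (Fin m) (Fin 2))).trans
      ((Equiv.sumCongr P Q).trans (unionVertexEquiv k m))

lemma unionPairing_castAdd {k m : ℕ} (P : DirectedPairing k) (Q : DirectedPairing m) (l : Fin k)
    (e : Fin 2) :
    unionPairing P Q (Fin.castAdd m l, e) = unionVertexEquiv k m (Sum.inl (P (l, e))) := by
  simp [unionPairing]

lemma unionPairing_natAdd {k m : ℕ} (P : DirectedPairing k) (Q : DirectedPairing m) (l : Fin m)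
    (e : Fin 2) :
    unionPairing P Q (Fin.natAdd k l, e) = unionVertexEquiv k m (Sum.inr (Q (l, e))) := by
  simp [unionPairing]

lemma unionPairing_refPairing (k m : ℕ) :
    unionPairing (refPairing k) (refPairing m) = refPairing (k + m) := by
  ext ⟨l, e⟩
  refine Fin.addCases (fun l => ?_) (fun l => ?_) l
  · rw [unionPairing_castAdd]
    simp [unionVertexEquiv, refPairing, finProdFinEquiv]
  · rw [unionPairing_natAdd]
    simp [unionVertexEquiv, refPairing, finProdFinEquiv]
    ring

lemma pairingSign_union {k m : ℕ} (P : DirectedPairing k) (Q : DirectedPairing m) :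
    pairingSign (refPairing (k + m)) (unionPairing P Q) =
      pairingSign (refPairing k) P * pairingSign (refPairing m) Q := by
  have h : (refPairing (k + m)).symm.trans (unionPairing P Q) =
      ((unionVertexEquiv k m).symm.trans (Equiv.sumCongr ((refPairing k).symm.trans P)
        ((refPairing m).symm.trans Q))).trans (unionVertexEquiv k m) := by
    rw [← unionPairing_refPairing]
    ext v
    obtain ⟨⟨l, e⟩, rfl⟩ := (unionPairing (refPairing k) (refPairing m)).surjective v
    rw [Equiv.trans_apply, Equiv.symm_apply_apply]
    refine Fin.addCases (fun l => ?_) (fun l => ?_) l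
    · simp [unionPairing_castAdd]
    · simp [unionPairing_natAdd]
  rw [pairingSign, h]
  exact (Equiv.Perm.sign_symm_trans_trans _ _).trans (Equiv.Perm.sign_sumCongr _ _)

/-- The disjoint union of two directed graphs. -/
def unionGraph {k m : ℕ} (E : DirectedGraph D k) (F : DirectedGraph D m) :
    DirectedGraph D (k + m) := fun c => unionPairing (E c) (F c)

lemma undirected_mate_apply {k : ℕ} (E : DirectedGraph D k) (c : Fin D) (l : Fin k) (e : Fin 2) :
    E.undirected.mate c (E c (l, e)) = E c (l, e + 1) := by
  simp [DirectedGraph.undirected]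

lemma undirected_unionGraph {k m : ℕ} (E : DirectedGraph D k) (F : DirectedGraph D m) :
    (unionGraph E F).undirected = (E.undirected.sum F.undirected).map (unionVertexEquiv k m) := by
  ext1
  funext c v
  obtain ⟨⟨l, e⟩, rfl⟩ := (unionGraph E F c).surjective v
  rw [undirected_mate_apply]
  refine Fin.addCases (fun l => ?_) (fun l => ?_) l
  · rw [unionGraph, unionPairing_castAdd, unionPairing_castAdd, ColoredGraph.map_mate_apply,
      ColoredGraph.sum_mate_inl, undirected_mate_apply]
  · rw [unionGraph, unionPairing_natAdd, unionPairing_natAdd, ColoredGraph.map_mate_apply,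
      ColoredGraph.sum_mate_inr, undirected_mate_apply]

lemma word_unionVertexEquiv (T : Idx N → A) {k m : ℕ} (a : Fin (2 * (k + m)) → Idx N) :
    word T a = word T (fun i => a (unionVertexEquiv k m (Sum.inl i))) *
      word T (fun i => a (unionVertexEquiv k m (Sum.inr i))) := by
  rw [word, List.ofFn_congr (by ring : 2 * (k + m) = 2 * k + 2 * m), List.ofFn_add,
    List.prod_append]
  rfl

/-- Words concatenate and the reference pairing of the union is the union of the reference pairings,
so no reordering sign arises. -/
lemma traceInvariant_mul (T : Idx N → A) {k m : ℕ} (E : DirectedGraph D k)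
    (F : DirectedGraph D m) :
    traceInvariant par N T E * traceInvariant par N T F =
      traceInvariant par N T (unionGraph E F) := by
  simp only [traceInvariant_eq, Finset.sum_mul_sum]
  rw [← Fintype.sum_prod_type', ← Equiv.sum_comp (Equiv.sumArrowEquivProdArrow _ _ _),
    ← Equiv.sum_comp ((unionVertexEquiv k m).symm.arrowCongr (Equiv.refl (Idx N)))]
  refine Finset.sum_congr rfl fun a _ => ?_
  rw [smul_mul_smul_comm, word_unionVertexEquiv]
  congr 1
  simp only [traceCoeff, ← Finset.prod_mul_distrib]
  refine Finset.prod_congr rfl fun c _ => ?_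
  rw [unionGraph, pairingSign_union, Fin.prod_univ_add]
  simp only [unionPairing_castAdd, unionPairing_natAdd]
  push_cast
  rw [mul_pow]
  exact mul_mul_mul_comm _ _ _ _

lemma traceInvariant_empty (T : Idx N → A) :
    traceInvariant par N T (fun _ : Fin D => refPairing 0) = 1 := by
  simp [traceInvariant_eq, traceCoeff, word_zero, pairingSign]

/-- The vertices of a union over `Fin (n + 1)`. -/
def sigmaSuccEquiv {n : ℕ} (F : Fin (n + 1) → Type) : F 0 ⊕ (Σ i : Fin n, F i.succ) ≃ Σ i, F i where
  toFun := Sum.elim (fun x => ⟨0, x⟩) fun x => ⟨x.1.succ, x.2⟩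
  invFun x := Fin.cases (motive := fun i => F i → F 0 ⊕ (Σ i : Fin n, F i.succ)) Sum.inl
    (fun i x => Sum.inr ⟨i, x⟩) x.1 x.2
  left_inv x := by rcases x with x | x <;> rfl
  right_inv x := by
    rcases x with ⟨i, x⟩
    induction i using Fin.cases <;> rfl

lemma map_sigmaSuccEquiv {C : Type} {n : ℕ} {F : Fin (n + 1) → Type}
    (G : ∀ i, ColoredGraph C (F i)) :
    ((G 0).sum (ColoredGraph.sigma fun i : Fin n => G i.succ)).map (sigmaSuccEquiv F) =
      ColoredGraph.sigma G := by
  ext1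
  funext c x
  obtain ⟨y, rfl⟩ := (sigmaSuccEquiv F).surjective x
  rw [ColoredGraph.map_mate_apply]
  rcases y with y | y <;> rfl

lemma exists_prod_traceInvariant (T : Idx N → A) (rep : (B : TraceGraph D) → DirectedGraph D B.1)
    (hrep : ∀ B, (rep B).undirected = B.2) {n : ℕ} (b : Fin n → TraceGraph D) :
    ∃ (K : ℕ) (Γ : DirectedGraph D K) (u : UnionVertex b ≃ Fin (2 * K)),
      Γ.undirected = (ColoredGraph.sigma fun i => (b i).2).map u ∧
      (List.ofFn fun i => traceInvariant par N T (rep (b i))).prod = traceInvariant par N T Γ := by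
  induction n with
  | zero =>
    have : IsEmpty (Fin (2 * 0)) := Fin.isEmpty
    refine ⟨0, fun _ => refPairing 0, Equiv.equivOfIsEmpty _ _, ?_, ?_⟩
    · ext _ v
      exact v.elim0
    · rw [traceInvariant_empty]
      simp
  | succ n ih =>
    obtain ⟨K, Γ, u, hu, hprod⟩ := ih fun i => b i.succ
    refine ⟨_, unionGraph (rep (b 0)) Γ, (sigmaSuccEquiv fun i => Fin (2 * (b i).1)).symm.trans
      ((Equiv.sumCongr (Equiv.refl _) u).trans (unionVertexEquiv _ _)), ?_, ?_⟩
    · rw [undirected_unionGraph, hrep, hu, ← map_sigmaSuccEquiv, ColoredGraph.map_map]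
      ext1
      funext c v
      obtain ⟨x, rfl⟩ := (unionVertexEquiv _ _).surjective v
      rcases x with x | x <;> simp [ColoredGraph.map]
    · rw [List.ofFn_succ, List.prod_cons, hprod, traceInvariant_mul]

variable {E : A →ₗ[ℂ] ℂ}

theorem expectation_prod (hN : ∀ c, par c = 1 → Even (N c))
    (hE : IsGaussian (∑ c, (par c : ℕ)) (fun a b => formMatrix par N b a) T E)
    (rep : (B : TraceGraph D) → DirectedGraph D B.1)
    (hrep : ∀ B, (rep B).undirected = B.2) {n : ℕ} (b : Fin n → TraceGraph D) :
    E (List.ofFn fun i => traceInvariant par N T (rep (b i))).prod =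
      extSum par (fun c => (N c : ℤ)) (ColoredGraph.sigma fun i => (b i).2) := by
  obtain ⟨K, Γ, u, hu, hprod⟩ := exists_prod_traceInvariant par N T rep hrep b
  rw [hprod, expectation_traceInvariant par N hN hE, hu, extSum_map]

theorem expectation_prod_mul (hN : ∀ c, par c = 1 → Even (N c))
    (hE : IsGaussian (∑ c, (par c : ℕ)) (fun a b => formMatrix par N b a) T E)
    (rep : (B : TraceGraph D) → DirectedGraph D B.1)
    (hrep : ∀ B, (rep B).undirected = B.2) {n : ℕ} (b : Fin (n + 1) → TraceGraph D) :
    E ((List.ofFn fun i : Fin n => traceInvariant par N T (rep (b i.succ))).prod *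
        traceInvariant par N T (rep (b 0))) =
      extSum par (fun c => (N c : ℤ)) (ColoredGraph.sigma fun i => (b i).2) := by
  obtain ⟨K, Γ, u, hu, hprod⟩ := exists_prod_traceInvariant par N T rep hrep fun i => b i.succ
  rw [hprod, traceInvariant_mul, expectation_traceInvariant par N hN hE, undirected_unionGraph,
    extSum_map, hu, hrep, ← map_sigmaSuccEquiv, extSum_map,
    -- The marked invariant is the last factor of the integrand but the bubble at position `0`; the
    -- exchange is a relabeling of vertices.
    ← extSum_map _ _ ((Equiv.sumCongr u (Equiv.refl _)).symm.trans (Equiv.sumComm _ _))]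
  refine congrArg (fun H => ((extSum par (fun c => (N c : ℤ)) H : ℤ) : ℂ)) ?_
  ext1
  funext c v
  rcases v with x | x <;> simp [ColoredGraph.map]

end Expectation

/-! ### Coefficients of the perturbative series -/

section Typed

variable {σ : Type}

open Classical in
/-- The sequences of `n` variables whose product is a given monomial. -/
def typed (n : ℕ) (p : σ →₀ ℕ) : Finset (Fin n → σ) :=
  (Fintype.piFinset fun _ : Fin n => p.support).filter fun b => ∑ i, Finsupp.single (b i) 1 = p

lemma mem_typed {n : ℕ} {p : σ →₀ ℕ} {b : Fin n → σ} :
    b ∈ typed n p ↔ ∑ i, Finsupp.single (b i) 1 = p := by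
  classical
  simp only [typed, Finset.mem_filter, Fintype.mem_piFinset, and_iff_right_iff_imp]
  rintro rfl i
  rw [Finsupp.mem_support_iff, Finsupp.finsetSum_apply]
  intro h
  have := Finset.sum_eq_zero_iff.1 h i (Finset.mem_univ i)
  simp at this

lemma eq_degree_of_mem_typed {n : ℕ} {p : σ →₀ ℕ} {b : Fin n → σ} (h : b ∈ typed n p) :
    n = p.degree := by
  rw [← mem_typed.1 h, map_sum]
  simp

lemma typed_eq_empty {n : ℕ} {p : σ →₀ ℕ} (h : n ≠ p.degree) : typed n p = ∅ :=
  Finset.eq_empty_of_forall_notMem fun _ hb => h (eq_degree_of_mem_typed hb)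

variable {A : Type} [Ring A]

-- The coefficients `y s` need not commute, so the sum runs over ordered sequences of variables
-- rather than over multinomials.
open Classical in
lemma coeff_pow_typed (F : MvPowerSeries σ A) (y : σ → A)
    (hF : ∀ s, MvPowerSeries.coeff (Finsupp.single s 1) F = y s)
    (hF0 : ∀ p, (∀ s, p ≠ Finsupp.single s 1) → MvPowerSeries.coeff p F = 0) (n : ℕ)
    (p : σ →₀ ℕ) :
    MvPowerSeries.coeff p (F ^ n) = ∑ b ∈ typed n p, (List.ofFn fun i => y (b i)).prod := by
  induction n generalizing p with
  | zero =>
    rw [pow_zero, MvPowerSeries.coeff_one]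
    split_ifs with h
    · subst h
      rw [show typed 0 (0 : σ →₀ ℕ) = Finset.univ from Finset.eq_univ_iff_forall.2 fun b =>
        mem_typed.2 (by simp)]
      simp
    · rw [typed_eq_empty, Finset.sum_empty]
      intro h0
      exact h ((Finsupp.degree_eq_zero_iff p).1 h0.symm)
  | succ n ih =>
    rw [pow_succ', MvPowerSeries.coeff_mul]
    have h1 : ∀ q, MvPowerSeries.coeff q F =
        ∑ s ∈ p.support with q = Finsupp.single s 1, y s +
          if ∃ s ∈ p.support, q = Finsupp.single s 1 then 0 else MvPowerSeries.coeff q F := by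
      intro q
      split_ifs with h
      · obtain ⟨s, hs, rfl⟩ := h
        rw [hF, add_zero, Finset.sum_eq_single s]
        · intro t ht hts
          rw [Finset.mem_filter] at ht
          exact absurd (Finsupp.single_left_injective one_ne_zero ht.2).symm hts
        · intro h
          exact absurd (Finset.mem_filter.2 ⟨hs, by rfl⟩) h
      · rw [Finset.filter_eq_empty_iff.2, Finset.sum_empty, zero_add]
        intro s hs hq
        exact h ⟨s, hs, hq⟩
    have h2 : ∀ x ∈ Finset.HasAntidiagonal.antidiagonal p, MvPowerSeries.coeff x.1 F *
        MvPowerSeries.coeff x.2 (F ^ n) =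
        ∑ s ∈ p.support with x.1 = Finsupp.single s 1, ∑ b ∈ typed n x.2,
          y s * (List.ofFn fun i => y (b i)).prod := by
      intro x hx
      rw [Finset.HasAntidiagonal.mem_antidiagonal] at hx
      rw [h1, ih, ← Finset.sum_mul_sum]
      split_ifs with h
      · rw [add_zero]
      · rw [hF0, add_zero]
        intro s hs
        refine h ⟨s, ?_, hs⟩
        rw [← hx, hs]
        simp
    rw [Finset.sum_congr rfl h2]
    simp_rw [Finset.sum_sigma']
    refine Finset.sum_bij (fun x _ => Fin.cons x.2.1 x.2.2) ?_ ?_ ?_ ?_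
    · rintro ⟨⟨q, r⟩, s, b⟩ h
      simp only [Finset.mem_sigma, Finset.HasAntidiagonal.mem_antidiagonal, Finset.mem_filter, mem_typed] at h ⊢
      rw [Fin.sum_univ_succ]
      simp only [Fin.cons_zero, Fin.cons_succ]
      rw [h.2.2, ← h.1, h.2.1.2]
    · rintro ⟨⟨q, r⟩, s, b⟩ h ⟨⟨q', r'⟩, s', b'⟩ h' heq
      simp only [Finset.mem_sigma, Finset.HasAntidiagonal.mem_antidiagonal, Finset.mem_filter, mem_typed] at h h'
      obtain ⟨rfl, rfl⟩ := Fin.cons_injective2 heq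
      obtain ⟨-, ⟨-, rfl⟩, rfl⟩ := h
      obtain ⟨-, ⟨-, rfl⟩, rfl⟩ := h'
      rfl
    · intro b hb
      rw [mem_typed, Fin.sum_univ_succ] at hb
      refine ⟨⟨⟨Finsupp.single (b 0) 1, ∑ i : Fin n, Finsupp.single (b i.succ) 1⟩, b 0,
        fun i => b i.succ⟩, ?_, ?_⟩
      · simp only [Finset.mem_sigma, Finset.HasAntidiagonal.mem_antidiagonal, Finset.mem_filter, mem_typed, hb,
          and_true, true_and]
        rw [← hb]
        simp
      · exact Fin.cons_self_tail b
    · rintro ⟨⟨q, r⟩, s, b⟩ h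
      simp [List.ofFn_succ]

lemma prod_ofFn_smul [Algebra ℂ A] {n : ℕ} (w : Fin n → ℂ) (x : Fin n → A) :
    (List.ofFn fun i => w i • x i).prod = (∏ i, w i) • (List.ofFn x).prod := by
  induction n with
  | zero => simp
  | succ n ih => simp only [List.ofFn_succ, List.prod_cons, ih, Fin.prod_univ_succ, smul_mul_smul_comm]

/-- `F` is homogeneous of degree one, so only the power `n = p.degree` contributes. -/
lemma coeff_formalExp_typed [Algebra ℂ A] (F : MvPowerSeries σ A) (y : σ → A)
    (hF : ∀ s, MvPowerSeries.coeff (Finsupp.single s 1) F = y s)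
    (hF0 : ∀ p, (∀ s, p ≠ Finsupp.single s 1) → MvPowerSeries.coeff p F = 0) (p : σ →₀ ℕ) :
    MvPowerSeries.coeff p (formalExp F) = ((p.degree.factorial : ℂ)⁻¹) •
      ∑ b ∈ typed p.degree p, (List.ofFn fun i => y (b i)).prod := by
  change ∑ n ∈ Finset.range (p.degree + 1), _ = _
  simp_rw [coeff_pow_typed F y hF hF0]
  rw [Finset.sum_eq_single p.degree]
  · intro n _ hn
    rw [typed_eq_empty hn, Finset.sum_empty, smul_zero]
  · simp

/-- Splitting the sequences of variables in two parts. -/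
lemma sum_typed_split [Finset.HasAntidiagonal (σ →₀ ℕ)] {n m r : ℕ} (e : Fin m ⊕ Fin r ≃ Fin n) (φ : (Fin m → σ) → ℂ)
    (ψ : (Fin r → σ) → ℂ) (p : σ →₀ ℕ) :
    ∑ b ∈ typed n p, φ (fun i => b (e (Sum.inl i))) * ψ (fun i => b (e (Sum.inr i))) =
      ∑ x ∈ Finset.HasAntidiagonal.antidiagonal p, (∑ b ∈ typed m x.1, φ b) * ∑ b ∈ typed r x.2, ψ b := by
  classical
  simp_rw [Finset.sum_mul_sum, Finset.sum_sigma']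
  have hsum : ∀ b : Fin n → σ, ∑ i, Finsupp.single (b (e (Sum.inl i))) 1 +
      ∑ i, Finsupp.single (b (e (Sum.inr i))) 1 = ∑ i, Finsupp.single (b i) 1 := fun b => by
    rw [← Equiv.sum_comp e, Fintype.sum_sum_type]
  refine Finset.sum_bij (fun b _ => ⟨⟨∑ i, Finsupp.single (b (e (Sum.inl i))) 1,
    ∑ i, Finsupp.single (b (e (Sum.inr i))) 1⟩, fun i => b (e (Sum.inl i)),
    fun i => b (e (Sum.inr i))⟩) ?_ ?_ ?_ ?_
  · intro b hb
    simp only [Finset.mem_sigma, Finset.HasAntidiagonal.mem_antidiagonal, mem_typed, and_true]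
    rw [hsum, mem_typed.1 hb]
  · intro b _ b' _ h
    simp only [Sigma.mk.injEq, heq_eq_eq] at h
    obtain ⟨-, h1, h2⟩ := h
    funext i
    obtain ⟨x, rfl⟩ := e.surjective i
    rcases x with x | x
    · exact congrFun h1 x
    · exact congrFun h2 x
  · rintro ⟨⟨q, r⟩, b₁, b₂⟩ h
    simp only [Finset.mem_sigma, Finset.HasAntidiagonal.mem_antidiagonal, mem_typed] at h
    obtain ⟨h, rfl, rfl⟩ := h
    refine ⟨fun i => Sum.elim b₁ b₂ (e.symm i), ?_, ?_⟩
    · rw [mem_typed, ← hsum]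
      simpa using h
    · simp
  · intro b _
    rfl

end Typed

section Series

variable {D : ℕ} {𝔅 : Set (TraceGraph D)}

/-- The weight `-1 / |V(B)|` of a bubble. -/
def bubbleWeight (B : 𝔅) : ℂ := -(B.1.order : ℂ)⁻¹

lemma couplingFactor_eq {n : ℕ} (b : Fin n → 𝔅) :
    couplingFactor b = MvPowerSeries.monomial (∑ i, Finsupp.single (b i) 1)
      ((n.factorial : ℂ)⁻¹ * ∏ i, bubbleWeight (b i)) := by
  have h : ∀ s : Finset (Fin n), ∏ i ∈ s, (MvPowerSeries.C (-((b i).1.order : ℂ)⁻¹) *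
      MvPowerSeries.X (b i)) = MvPowerSeries.monomial (∑ i ∈ s, Finsupp.single (b i) 1)
      (∏ i ∈ s, bubbleWeight (b i)) := by
    classical
    intro s
    induction s using Finset.induction_on with
    | empty => simp [MvPowerSeries.monomial_zero_one]
    | insert a s ha ih =>
      rw [Finset.prod_insert ha, Finset.sum_insert ha, Finset.prod_insert ha, ih,
        MvPowerSeries.X, ← MvPowerSeries.monomial_zero_eq_C_apply,
        MvPowerSeries.monomial_mul_monomial, MvPowerSeries.monomial_mul_monomial, zero_add,
        mul_one]
      rfl
  rw [couplingFactor, h, ← MvPowerSeries.monomial_zero_eq_C_apply,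
    MvPowerSeries.monomial_mul_monomial, zero_add]

open Classical in
lemma coeff_couplingFactor_mul {n : ℕ} (b : Fin n → 𝔅) (z : ℂ) (p : 𝔅 →₀ ℕ) :
    MvPowerSeries.coeff p (couplingFactor b * MvPowerSeries.C z) =
      if b ∈ typed n p then (n.factorial : ℂ)⁻¹ * ((∏ i, bubbleWeight (b i)) * z) else 0 := by
  rw [couplingFactor_eq, ← MvPowerSeries.monomial_zero_eq_C_apply,
    MvPowerSeries.monomial_mul_monomial, add_zero, MvPowerSeries.coeff_monomial, mul_assoc]
  exact if_congr (by rw [mem_typed, eq_comm]) rfl rfl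

/-- The formal power series of the sequences of bubbles with weights `z`. -/
def bubbleSeries (z : ∀ n, (Fin n → 𝔅) → ℂ) : MvPowerSeries 𝔅 ℂ := fun p =>
  (p.degree.factorial : ℂ)⁻¹ *
    ∑ b ∈ typed p.degree p, (∏ i, bubbleWeight (b i)) * z p.degree b

lemma coeff_bubbleSeries (z : ∀ n, (Fin n → 𝔅) → ℂ) (p : 𝔅 →₀ ℕ) :
    MvPowerSeries.coeff p (bubbleSeries z) = (p.degree.factorial : ℂ)⁻¹ *
      ∑ b ∈ typed p.degree p, (∏ i, bubbleWeight (b i)) * z p.degree b := rfl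

/-- A monomial fixes the number of bubbles and their multiset, which leaves finitely many sequences
and finitely many graphs for each; `e` presents the graphs as this disjoint union. -/
lemma isFormalSum_bubbleSeries {ι : Type} {Q : (Σ n, Fin n → 𝔅) → Type} [∀ x, Fintype (Q x)]
    (e : (Σ x, Q x) ≃ ι) (f : ι → MvPowerSeries 𝔅 ℂ) (z : ∀ x, Q x → ℂ)
    (hf : ∀ x q, f (e ⟨x, q⟩) = couplingFactor x.2 * MvPowerSeries.C (z x q)) :
    IsFormalSum f (bubbleSeries fun n b => ∑ q : Q ⟨n, b⟩, z ⟨n, b⟩ q) := by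
  classical
  intro p
  let S : Finset (Σ x, Q x) := ((typed p.degree p).map
    (Function.Embedding.sigmaMk (β := fun n => Fin n → 𝔅) p.degree)).sigma fun _ => Finset.univ
  have hS : (Function.support fun y => MvPowerSeries.coeff p (f (e y))) ⊆ S := by
    rintro ⟨⟨n, b⟩, q⟩ h
    rw [Function.mem_support, hf, coeff_couplingFactor_mul] at h
    have hb : b ∈ typed n p := by
      by_contra hb
      exact h (if_neg hb)
    obtain rfl := eq_degree_of_mem_typed hb
    simpa [S] using hb
  constructor
  · have h : {G | MvPowerSeries.coeff p (f G) ≠ 0} ⊆ e '' S := by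
      intro G hG
      refine ⟨e.symm G, hS ?_, e.apply_symm_apply G⟩
      rw [Function.mem_support, e.apply_symm_apply]
      exact hG
    exact (S.finite_toSet.image e).subset h
  · rw [← finsum_comp_equiv e, finsum_eq_sum_of_support_subset _ hS, coeff_bubbleSeries,
      Finset.sum_sigma, Finset.sum_map, Finset.mul_sum]
    refine Finset.sum_congr rfl fun b hb => ?_
    rw [Finset.mul_sum, Finset.mul_sum]
    refine Finset.sum_congr rfl fun q _ => ?_
    refine Eq.trans ?_ (congrArg _ (hf ⟨p.degree, b⟩ q)).symm
    rw [coeff_couplingFactor_mul]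
    exact (if_pos hb).symm

/-- The product of two series of bubbles. -/
lemma bubbleSeries_mul (u z : ∀ n, (Fin n → 𝔅) → ℂ) :
    bubbleSeries u * bubbleSeries z = bubbleSeries fun n b => ∑ S : Finset (Fin n),
      u S.card (fun i => b ((finSumEquivOfFinset rfl rfl :
        Fin S.card ⊕ Fin Sᶜ.card ≃ Fin n) (Sum.inl i))) *
      z Sᶜ.card (fun i => b ((finSumEquivOfFinset rfl rfl :
        Fin S.card ⊕ Fin Sᶜ.card ≃ Fin n) (Sum.inr i))) := by
  classical
  ext p
  rw [MvPowerSeries.coeff_mul, coeff_bubbleSeries]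
  simp_rw [Finset.mul_sum (s := (Finset.univ : Finset (Finset (Fin p.degree))))]
  rw [Finset.sum_comm]
  have h1 : ∀ S : Finset (Fin p.degree), ∑ b ∈ typed p.degree p, (∏ i, bubbleWeight (b i)) *
      (u S.card (fun i => b ((finSumEquivOfFinset rfl rfl :
        Fin S.card ⊕ Fin Sᶜ.card ≃ Fin p.degree) (Sum.inl i))) *
      z Sᶜ.card (fun i => b ((finSumEquivOfFinset rfl rfl :
        Fin S.card ⊕ Fin Sᶜ.card ≃ Fin p.degree) (Sum.inr i)))) =
      ∑ x ∈ Finset.HasAntidiagonal.antidiagonal p,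
        (∑ b ∈ typed S.card x.1, (∏ i, bubbleWeight (b i)) * u S.card b) *
        ∑ b ∈ typed Sᶜ.card x.2, (∏ i, bubbleWeight (b i)) * z Sᶜ.card b := by
    intro S
    rw [← sum_typed_split (finSumEquivOfFinset rfl rfl :
        Fin S.card ⊕ Fin Sᶜ.card ≃ Fin p.degree)
        (fun b => (∏ i, bubbleWeight (b i)) * u S.card b)
        (fun b => (∏ i, bubbleWeight (b i)) * z Sᶜ.card b)]
    refine Finset.sum_congr rfl fun b _ => ?_
    rw [← Equiv.prod_comp (finSumEquivOfFinset rfl rfl :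
        Fin S.card ⊕ Fin Sᶜ.card ≃ Fin p.degree), Fintype.prod_sum_type]
    exact (mul_mul_mul_comm _ _ _ _).symm
  simp_rw [h1]
  rw [Finset.sum_comm, Finset.mul_sum]
  refine Finset.sum_congr rfl fun x hx => ?_
  rw [Finset.HasAntidiagonal.mem_antidiagonal] at hx
  have hdeg : p.degree = x.1.degree + x.2.degree := by rw [← hx, map_add]
  rw [coeff_bubbleSeries, coeff_bubbleSeries]
  have h2 : ∀ S : Finset (Fin p.degree),
      (∑ b ∈ typed S.card x.1, (∏ i, bubbleWeight (b i)) * u S.card b) *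
        ∑ b ∈ typed Sᶜ.card x.2, (∏ i, bubbleWeight (b i)) * z Sᶜ.card b =
      if S.card = x.1.degree then
        (∑ b ∈ typed x.1.degree x.1, (∏ i, bubbleWeight (b i)) * u x.1.degree b) *
        ∑ b ∈ typed x.2.degree x.2, (∏ i, bubbleWeight (b i)) * z x.2.degree b else 0 := by
    intro S
    split_ifs with h
    · have h' : Sᶜ.card = x.2.degree := by
        rw [Finset.card_compl, Fintype.card_fin]
        omega
      rw [h, h']
    · rw [typed_eq_empty h, Finset.sum_empty, zero_mul]
  simp_rw [h2]
  -- The subsets of the right size are counted by a binomial coefficient, which turns `1/n!` into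
  -- the two factorials of the factors.
  rw [← Finset.sum_filter, Finset.sum_const, nsmul_eq_mul, ← Fintype.card_subtype,
    Fintype.card_finset_len, Fintype.card_fin, hdeg, Nat.cast_add_choose ℂ]
  have f1 : ((x.1.degree + x.2.degree).factorial : ℂ) ≠ 0 := by
    exact_mod_cast Nat.factorial_ne_zero _
  field_simp

/-! ### The series of the model -/

variable (par : Fin D → Fin 2) (N : Fin D → ℕ) (rep : (B : TraceGraph D) → DirectedGraph D B.1)
  {A : Type} [Ring A] [Algebra ℂ A] {T : Idx N → A}

lemma coeff_interaction_single (T : Idx N → A) (B : 𝔅) :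
    MvPowerSeries.coeff (Finsupp.single B 1) (interaction par N 𝔅 rep T) =
      (B.1.order : ℂ)⁻¹ • traceInvariant par N T (rep B.1) := by
  classical
  change ∑ᶠ B' : 𝔅, _ = _
  rw [finsum_eq_single _ B]
  · rw [MvPowerSeries.coeff_monomial_same]
  · intro B' hB'
    rw [MvPowerSeries.coeff_monomial, if_neg]
    intro h
    exact hB' (Finsupp.single_left_injective one_ne_zero h).symm

lemma coeff_interaction_of_ne (T : Idx N → A) {p : 𝔅 →₀ ℕ} (hp : ∀ B, p ≠ Finsupp.single B 1) :
    MvPowerSeries.coeff p (interaction par N 𝔅 rep T) = 0 := by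
  classical
  change ∑ᶠ B' : 𝔅, _ = _
  rw [← finsum_zero (α := 𝔅)]
  congr 1
  funext B
  rw [MvPowerSeries.coeff_monomial, if_neg (hp B)]

lemma perturb_eq_bubbleSeries (T : Idx N → A) (E : A →ₗ[ℂ] ℂ) (f : A) :
    perturb par N 𝔅 rep T E f = bubbleSeries fun _ b =>
      E ((List.ofFn fun i => traceInvariant par N T (rep (b i).1)).prod * f) := by
  funext p
  have h := coeff_formalExp_typed (-interaction par N 𝔅 rep T)
    (fun B => bubbleWeight B • traceInvariant par N T (rep B.1))
    (fun B => by rw [map_neg, coeff_interaction_single, bubbleWeight, neg_smul])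
    (fun q hq => by rw [map_neg, coeff_interaction_of_ne par N rep T hq, neg_zero]) p
  rw [perturb, h, bubbleSeries, smul_mul_assoc, map_smul, Finset.sum_mul, map_sum, smul_eq_mul]
  congr 1
  refine Finset.sum_congr rfl fun b _ => ?_
  rw [prod_ofFn_smul, smul_mul_assoc, map_smul, smul_eq_mul]

variable (𝔅) in
/-- The series of the vacuum graphs. -/
def vacuumSeries : MvPowerSeries 𝔅 ℂ := bubbleSeries fun _ b =>
  (extSum par (fun c => (N c : ℤ)) (ColoredGraph.sigma fun i => (b i).1.2) : ℤ)

variable (𝔅) in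
/-- The series of the graphs with a marked bubble. -/
def markedSeries (B : TraceGraph D) : MvPowerSeries 𝔅 ℂ := bubbleSeries fun n b =>
  (extSum par (fun c => (N c : ℤ)) (ColoredGraph.sigma fun i =>
    ((Fin.cons B fun i => (b i).1 : Fin (n + 1) → TraceGraph D) i).2) : ℤ)

variable (𝔅) in
/-- The series of the graphs whose components meet a marked bubble. -/
def connectedSeries (B : TraceGraph D) : MvPowerSeries 𝔅 ℂ := bubbleSeries fun n b =>
  (connSum par (fun c => (N c : ℤ)) (Fin.cons B fun i => (b i).1 : Fin (n + 1) → TraceGraph D) : ℤ)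

variable {par N}

lemma perturb_one_eq (hN : ∀ c, par c = 1 → Even (N c)) {E : A →ₗ[ℂ] ℂ}
    (hE : IsGaussian (∑ c, (par c : ℕ)) (fun a b => formMatrix par N b a) T E)
    (hrep : ∀ B, (rep B).undirected = B.2) :
    perturb par N 𝔅 rep T E 1 = vacuumSeries 𝔅 par N := by
  rw [perturb_eq_bubbleSeries, vacuumSeries]
  congr 1
  funext n b
  rw [mul_one]
  exact expectation_prod par N hN hE rep hrep fun i => (b i).1

lemma perturb_invariant_eq (hN : ∀ c, par c = 1 → Even (N c)) {E : A →ₗ[ℂ] ℂ}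
    (hE : IsGaussian (∑ c, (par c : ℕ)) (fun a b => formMatrix par N b a) T E)
    (hrep : ∀ B, (rep B).undirected = B.2) (B : TraceGraph D) :
    perturb par N 𝔅 rep T E (traceInvariant par N T (rep B)) = markedSeries 𝔅 par N B := by
  rw [perturb_eq_bubbleSeries, markedSeries]
  congr 1
  funext n b
  exact expectation_prod_mul par N hN hE rep hrep
    (Fin.cons B fun i => (b i).1 : Fin (n + 1) → TraceGraph D)

/-- The two statistics enter only through `IsGaussian`, so they lead to the same series. -/
lemma partitionFunction_eq (hN : ∀ c, par c = 1 → Even (N c))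
    (hrep : ∀ B, (rep B).undirected = B.2) :
    partitionFunction par N 𝔅 rep = vacuumSeries 𝔅 par N := by
  rw [partitionFunction]
  split_ifs with hpar
  · rw [show fermionGaussian par N = fermionFunctional par N from
      funext (fermionGaussian_eq par N)]
    exact perturb_one_eq rep hN (isGaussian_fermion par N hN hpar) hrep
  · rw [Nat.not_odd_iff_even] at hpar
    rw [show bosonGaussian par N = bosonFunctional par N from
      funext (bosonGaussian_eq par N hN hpar)]
    exact perturb_one_eq rep hN (isGaussian_boson par N hN hpar) hrep

lemma invariantIntegral_eq (hN : ∀ c, par c = 1 → Even (N c))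
    (hrep : ∀ B, (rep B).undirected = B.2) (B : TraceGraph D) :
    invariantIntegral par N 𝔅 rep B = markedSeries 𝔅 par N B := by
  rw [invariantIntegral]
  split_ifs with hpar
  · rw [show fermionGaussian par N = fermionFunctional par N from
      funext (fermionGaussian_eq par N)]
    exact perturb_invariant_eq rep hN (isGaussian_fermion par N hN hpar) hrep B
  · rw [Nat.not_odd_iff_even] at hpar
    rw [show bosonGaussian par N = bosonFunctional par N from
      funext (bosonGaussian_eq par N hN hpar)]
    exact perturb_invariant_eq rep hN (isGaussian_boson par N hN hpar) hrep B

variable (par N)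

/-- `extSum_eq_sum_split` is a convolution over subsets of the labeled bubbles, which is what
multiplication of these exponential-type series amounts to. -/
lemma connectedSeries_mul_vacuumSeries (h𝔅 : ∀ B ∈ 𝔅, B.2.Connected) (B : TraceGraph D) :
    connectedSeries 𝔅 par N B * vacuumSeries 𝔅 par N = markedSeries 𝔅 par N B := by
  rw [connectedSeries, vacuumSeries, bubbleSeries_mul, markedSeries]
  congr 1
  funext n b
  rw [extSum_eq_sum_split par _ (Fin.cons B fun i => (b i).1 : Fin (n + 1) → TraceGraph D)
    fun i => h𝔅 _ (b i).2]
  push_cast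
  refine Finset.sum_congr rfl fun S _ => ?_
  congr 3
  funext i
  refine Fin.cases rfl (fun i => rfl) i

/-- The only extension is the empty graph, which has no faces; this makes the constant term of `Z`
equal to `1`, hence `Z` invertible. -/
lemma extSum_of_isEmpty {V : Type} [IsEmpty V] [Finite V] (N : Fin D → ℤ)
    (H : ColoredGraph (Fin D) V) : extSum par N H = 1 := by
  let u : Unique (ColoredGraph Unit V) :=
    { default := ⟨fun _ => isEmptyElim, fun _ => isEmptyElim, fun _ => isEmptyElim⟩
      uniq := fun _ => ColoredGraph.ext (funext fun _ => funext isEmptyElim) }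
  rw [extSum_eq_sum_addColor, Fintype.sum_unique, faceFactor]
  refine Finset.prod_eq_one fun c _ => ?_
  have h : IsEmpty ((addColor H default).restrictColors {c.succ, 0}).ConnectedComponent :=
    ⟨fun x => SimpleGraph.ConnectedComponent.ind isEmptyElim x⟩
  rw [ColoredGraph.faces, Nat.card_of_isEmpty, pow_zero]

lemma constantCoeff_vacuumSeries : MvPowerSeries.constantCoeff (vacuumSeries 𝔅 par N) = 1 := by
  classical
  rw [← MvPowerSeries.coeff_zero_eq_constantCoeff_apply, vacuumSeries, coeff_bubbleSeries]
  have h : typed 0 (0 : 𝔅 →₀ ℕ) = {Fin.elim0} := by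
    ext b
    simp [mem_typed, Subsingleton.elim b Fin.elim0]
  have h0 : Finsupp.degree (0 : 𝔅 →₀ ℕ) = 0 := map_zero _
  rw [h0, h, Finset.sum_singleton, extSum_of_isEmpty]
  simp

lemma connectedSeries_eq (h𝔅 : ∀ B ∈ 𝔅, B.2.Connected) (B : TraceGraph D) :
    connectedSeries 𝔅 par N B = (vacuumSeries 𝔅 par N)⁻¹ * markedSeries 𝔅 par N B := by
  rw [← connectedSeries_mul_vacuumSeries par N h𝔅, mul_left_comm,
    MvPowerSeries.inv_mul_cancel, mul_one]
  rw [constantCoeff_vacuumSeries]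
  exact one_ne_zero

/-! ### Sums over Feynman graphs -/

/-- Feynman graphs as a disjoint union over the sequences of bubbles. -/
def feynmanGraphEquiv : (Σ x : (Σ n, Fin n → 𝔅),
    {G : ColoredGraph (Fin (D + 1)) (UnionVertex fun i => (x.2 i).1) //
      Extends (fun i => (x.2 i).1) G}) ≃ FeynmanGraph 𝔅 where
  toFun y := ⟨y.1.1, y.1.2, y.2.1, y.2.2⟩
  invFun G := ⟨⟨G.n, G.bubble⟩, G.graph, G.extends_bubbles⟩
  left_inv _ := rfl
  right_inv _ := rfl

/-- Marked Feynman graphs as a disjoint union over the sequences of bubbles. -/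
def markedFeynmanGraphEquiv (B : TraceGraph D) : (Σ x : (Σ n, Fin n → 𝔅),
    {G : ColoredGraph (Fin (D + 1))
      (UnionVertex (Fin.cons B fun i => (x.2 i).1 : Fin (x.1 + 1) → TraceGraph D)) //
      Extends _ G ∧ MeetsFirst G}) ≃ MarkedFeynmanGraph 𝔅 B where
  toFun y := ⟨y.1.1, y.1.2, y.2.1, y.2.2.1, y.2.2.2⟩
  invFun G := ⟨⟨G.n, G.bubble⟩, G.graph, G.extends_bubbles, G.meets_marked⟩
  left_inv _ := rfl
  right_inv _ := rfl

theorem isFormalSum_vacuumSeries :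
    IsFormalSum (fun G : FeynmanGraph 𝔅 => G.amplitude par fun c => (N c : ℤ))
      (vacuumSeries 𝔅 par N) := by
  classical
  have h := isFormalSum_bubbleSeries (feynmanGraphEquiv (𝔅 := 𝔅))
    (fun G : FeynmanGraph 𝔅 => G.amplitude par fun c => (N c : ℤ))
    (fun x q => ((faceFactor par (fun c => (N c : ℤ)) q.1 : ℤ) : ℂ)) fun x q => rfl
  convert h using 1
  rw [vacuumSeries]
  congr 1
  funext n b
  rw [extSum, Int.cast_sum]
  exact Finset.sum_subtype _ (fun G => by
    rw [Finset.mem_filter, extends_iff]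
    exact and_iff_right (Finset.mem_univ _)) _

theorem isFormalSum_connectedSeries (B : TraceGraph D) :
    IsFormalSum (fun G : MarkedFeynmanGraph 𝔅 B => G.amplitude par fun c => (N c : ℤ))
      (connectedSeries 𝔅 par N B) := by
  classical
  have h := isFormalSum_bubbleSeries (markedFeynmanGraphEquiv (𝔅 := 𝔅) B)
    (fun G : MarkedFeynmanGraph 𝔅 B => G.amplitude par fun c => (N c : ℤ))
    (fun x q => ((faceFactor par (fun c => (N c : ℤ)) q.1 : ℤ) : ℂ)) fun x q => rfl
  convert h using 1
  rw [connectedSeries]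
  congr 1
  funext n b
  rw [connSum, Int.cast_sum]
  exact Finset.sum_subtype _ (fun G => by
    rw [Finset.mem_filter, extends_iff]
    exact and_iff_right (Finset.mem_univ _)) _

end Series

/-! ### Connectedness and duality -/

lemma MarkedFeynmanGraph.connected {D : ℕ} {𝔅 : Set (TraceGraph D)} {B : TraceGraph D}
    (hB : B.2.Connected) (G : MarkedFeynmanGraph 𝔅 B) : G.graph.Connected := by
  have hbubble : ∀ v w : Fin (2 * B.1),
      (G.graph.restrictColors Set.univ).Reachable ⟨0, v⟩ ⟨0, w⟩ :=
    reachable_bubble ((extends_iff _ _).1 G.extends_bubbles) (i := 0) hB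
  obtain ⟨v⟩ := hB.nonempty
  have hne : Nonempty (UnionVertex
    (Fin.cons B fun i => (G.bubble i).1 : Fin (G.n + 1) → TraceGraph D)) := ⟨⟨0, v⟩⟩
  refine SimpleGraph.Connected.mk fun x y => ?_
  obtain ⟨v, hv⟩ := G.meets_marked x
  obtain ⟨w, hw⟩ := G.meets_marked y
  exact (hv.trans (hbubble v w)).trans hw.symm

lemma faceFactor_flip {D : ℕ} {V : Type} (s : Finset (Fin D)) (par : Fin D → Fin 2)
    (N : Fin D → ℤ) (G : ColoredGraph (Fin (D + 1)) V) :
    faceFactor (flipParity s par) (flipSize s N) G = faceFactor par N G := by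
  refine Finset.prod_congr rfl fun c _ => ?_
  congr 1
  simp only [flipParity, flipSize]
  split_ifs
  · have h : ∀ x : Fin 2, (-1 : ℤ) ^ ((x + 1 : Fin 2) : ℕ) = -(-1) ^ (x : ℕ) := by decide
    rw [h, neg_mul_neg]
  · rfl

end TensorModel

end

/-! ### The graph expansions and the duality -/

theorem theorem1 {D : ℕ} (𝔅 : Set (TensorModel.TraceGraph D))
    (h𝔅 : ∀ B ∈ 𝔅, B.2.Connected ∧ 2 < B.order)
    (rep : (B : TensorModel.TraceGraph D) → TensorModel.DirectedGraph D B.1)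
    (hrep : ∀ B, (rep B).undirected = B.2) :
    -- the two series, for all parities and dimensions
    (∀ (par : Fin D → Fin 2) (N : Fin D → ℕ), (∀ c, par c = 1 → Even (N c)) →
      TensorModel.IsFormalSum
        (fun G : TensorModel.FeynmanGraph 𝔅 => G.amplitude par (fun c => (N c : ℤ)))
        (TensorModel.partitionFunction par N 𝔅 rep) ∧
      ∀ B : TensorModel.TraceGraph D,
        TensorModel.IsFormalSum
          (fun G : TensorModel.MarkedFeynmanGraph 𝔅 B => G.amplitude par (fun c => (N c : ℤ)))
          (TensorModel.expectation par N 𝔅 rep B)) ∧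
    -- for a connected invariant only connected graphs occur
    (∀ B : TensorModel.TraceGraph D, B.2.Connected →
      ∀ G : TensorModel.MarkedFeynmanGraph 𝔅 B, G.graph.Connected) ∧
    -- invariance of every graph amplitude, for every set of colors that is exchanged
    (∀ (s : Finset (Fin D)) (par : Fin D → Fin 2) (N : Fin D → ℤ),
      (∀ G : TensorModel.FeynmanGraph 𝔅,
        G.amplitude (TensorModel.flipParity s par) (TensorModel.flipSize s N) =
          G.amplitude par N) ∧
      ∀ (B : TensorModel.TraceGraph D) (G : TensorModel.MarkedFeynmanGraph 𝔅 B),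
        G.amplitude (TensorModel.flipParity s par) (TensorModel.flipSize s N) =
          G.amplitude par N) := by
  refine ⟨fun par N hN => ⟨?_, fun B => ?_⟩, fun B hB G => G.connected hB,
    fun s par N => ⟨fun G => ?_, fun B G => ?_⟩⟩
  · rw [TensorModel.partitionFunction_eq rep hN hrep]
    exact TensorModel.isFormalSum_vacuumSeries par N
  · rw [TensorModel.expectation, TensorModel.partitionFunction_eq rep hN hrep,
      TensorModel.invariantIntegral_eq rep hN hrep,
      ← TensorModel.connectedSeries_eq par N fun B hB => (h𝔅 B hB).1]
    exact TensorModel.isFormalSum_connectedSeries par N B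
  · rw [TensorModel.FeynmanGraph.amplitude, TensorModel.faceFactor_flip]
    rfl
  · rw [TensorModel.MarkedFeynmanGraph.amplitude, TensorModel.faceFactor_flip]
    rfl
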